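/- A simple graph on a vertex set $V$ is a threshold graph if there are real weights $(w_v)_{v\in V}$ and a real number $t$ such that distinct vertices $u,v$ are adjacent if and only if $w_u+w_v>t$. Let $T_n$ be uniformly distributed on the set of unlabeled threshold graphs of order $n$ (isomorphism classes), and let $T^L_n$ be uniformly distributed on the set of labeled threshold graphs on $\{1,\dots,n\}$. Let $N_d(G)$ be the number of vertices of degree $d$ in $G$. (i) (Unlabeled case.) For any sequence $d=d(n)$ with $0\le d\le n-1$, as $n\to\infty$, $N_d(T_n)$ converges in distribution to $\mathrm{Ge}(1/2)$, the law with $P(X=k)=2^{-k-1}$ for $k\ge 0$, with convergence of all moments. (ii) (Labeled case.) Let $R_d=\sum_{k=1}^d k!\,S(d,k)$ for $d\ge1$, where $S(d,k)$ are the Stirling numbers of the second kind. Put $\gamma_0=\log 2$, $\gamma_d=2R_d(\log 2)^{d+1}/d!$ for $1\le d<\infty$, and $\gamma_\infty=1$. For $0\le d\le\infty$ let $X_d$ have the modified Poisson distribution $$P(X_d=\ell)=\frac{\gamma_d}{\log 2}\,P(\mathrm{Po}(\log 2)=\ell)=\gamma_d\,\frac{(\log 2)^{\ell-1}}{2\cdot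 \ell!}\quad(\ell\ge 1),\qquad P(X_d=0)=1-\frac{\gamma_d}{2\log 2},$$ which has mean $\gamma_d$. For all $0\le d\le n-1$, $N_d(T^L_n)$ and $N_{n-1-d}(T^L_n)$ have the same distribution. For every fixed $d\ge 0$, $N_d(T^L_n)$ and $N_{n-1-d}(T^L_n)$ converge in distribution to $X_d$ as $n\to\infty$; for every sequence $d=d(n)\to\infty$ with $n-d\to\infty$, $N_d(T^L_n)$ and $N_{n-1-d}(T^L_n)$ converge in distribution to $X_\infty$ as $n\to\infty$; in both cases with convergence of all moments. In particular, $E N_d(T^L_n)=E N_{n-1-d}(T^L_n)$ converges to $\gamma_d$ for every fixed $d$, and to $\gamma_\infty=1$ if $d\to\infty$ and $n-d\to\infty$. -/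

import Mathlib

open MeasureTheory ProbabilityTheory Filter Topology

noncomputable section

namespace ThresholdGraph

/-! ### Threshold graphs, labeled and unlabeled -/

/-- A simple graph is a threshold graph if there are real vertex weights `w` and a threshold `t`
such that distinct vertices `i`, `j` are adjacent if and only if `w i + w j > t`. -/
def IsThreshold {V : Type*} (G : SimpleGraph V) : Prop :=
  ∃ (w : V → ℝ) (t : ℝ), ∀ i j : V, i ≠ j → (G.Adj i j ↔ t < w i + w j)

/-- The labeled threshold graphs of order `n`. -/
def Labeled (n : ℕ) : Type := {G : SimpleGraph (Fin n) // IsThreshold G}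

/-- Two labeled threshold graphs represent the same unlabeled graph if they are isomorphic. -/
instance labeledSetoid (n : ℕ) : Setoid (Labeled n) where
  r G H := Nonempty (G.1 ≃g H.1)
  iseqv :=
    { refl := fun _ => ⟨SimpleGraph.Iso.refl⟩
      symm := fun ⟨e⟩ => ⟨e.symm⟩
      trans := fun ⟨e⟩ ⟨f⟩ => ⟨e.trans f⟩ }

/-- The unlabeled threshold graphs of order `n`: isomorphism classes of threshold graphs. -/
def Unlabeled (n : ℕ) : Type := Quotient (labeledSetoid n)

instance (n : ℕ) : Finite (Labeled n) :=
  inferInstanceAs (Finite {G : SimpleGraph (Fin n) // IsThreshold G})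

instance (n : ℕ) : Nonempty (Labeled n) :=
  ⟨⟨⊥, 0, 0, fun i j _ => by simp⟩⟩

instance (n : ℕ) : Finite (Unlabeled n) :=
  inferInstanceAs (Finite (Quotient (labeledSetoid n)))

instance (n : ℕ) : Nonempty (Unlabeled n) :=
  (inferInstance : Nonempty (Labeled n)).map (Quotient.mk (labeledSetoid n))

instance (n : ℕ) : Fintype (Labeled n) := Fintype.ofFinite _

instance (n : ℕ) : Fintype (Unlabeled n) := Fintype.ofFinite _

instance (n : ℕ) : MeasurableSpace (Labeled n) := ⊤

instance (n : ℕ) : MeasurableSpace (Unlabeled n) := ⊤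

/-- The uniform distribution on labeled threshold graphs of order `n`. -/
def uniformLabeled (n : ℕ) : Measure (Labeled n) :=
  (PMF.uniformOfFintype (Labeled n)).toMeasure

/-- The uniform distribution on unlabeled threshold graphs of order `n`. -/
def uniformUnlabeled (n : ℕ) : Measure (Unlabeled n) :=
  (PMF.uniformOfFintype (Unlabeled n)).toMeasure

instance (n : ℕ) : IsProbabilityMeasure (uniformLabeled n) :=
  inferInstanceAs (IsProbabilityMeasure (PMF.uniformOfFintype (Labeled n)).toMeasure)

instance (n : ℕ) : IsProbabilityMeasure (uniformUnlabeled n) :=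
  inferInstanceAs (IsProbabilityMeasure (PMF.uniformOfFintype (Unlabeled n)).toMeasure)

open Classical in
/-- The number `N_d(G)` of vertices of degree `d` in the graph `G`. -/
def degreeCount {V : Type*} [Fintype V] (G : SimpleGraph V) (d : ℕ) : ℕ :=
  (Finset.univ.filter fun v : V => G.degree v = d).card

lemma degreeCount_congr {V W : Type*} [Fintype V] [Fintype W] {G : SimpleGraph V}
    {H : SimpleGraph W} (e : G ≃g H) (d : ℕ) : degreeCount G d = degreeCount H d := by
  classical
  unfold degreeCount
  refine Finset.card_equiv e.toEquiv fun v => ?_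
  simp only [Finset.mem_filter, Finset.mem_univ, true_and]
  have h := e.degree_eq v
  have h2 : H.degree (e.toEquiv v) = G.degree v := by
    exact h
  constructor
  · intro hv
    convert h2.trans (by convert hv)
  · intro hv
    convert h2.symm.trans (by convert hv)

/-- `N_d` as a random variable on labeled threshold graphs. -/
def countLabeled {n : ℕ} (d : ℕ) (G : Labeled n) : ℕ := degreeCount G.1 d

/-- `N_d` as a random variable on unlabeled threshold graphs. -/
def countUnlabeled {n : ℕ} (d : ℕ) (G : Unlabeled n) : ℕ :=
  Quotient.lift (s := labeledSetoid n) (fun H : Labeled n => degreeCount H.1 d)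
    (fun _ _ ⟨e⟩ => degreeCount_congr e d) G

/-! ### Convergence in distribution with all moments -/

/-- The random variables `X n` (with values in `ℕ`) converge in distribution to `ν`, with
convergence of all moments; all the moments involved are finite. -/
structure TendstoWithMoments {Ω : ℕ → Type*} [∀ n, MeasurableSpace (Ω n)]
    (μ : (n : ℕ) → Measure (Ω n)) [∀ n, IsProbabilityMeasure (μ n)]
    (X : (n : ℕ) → Ω n → ℕ) (ν : Measure ℕ) [IsProbabilityMeasure ν] : Prop where
  tendstoInDistribution : TendstoInDistribution X atTop id μ ν
  integrable_pow : ∀ n k : ℕ, Integrable (fun ω => (X n ω : ℝ) ^ k) (μ n)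
  integrable_pow_limit : ∀ k : ℕ, Integrable (fun x : ℕ => (x : ℝ) ^ k) ν
  tendsto_moment : ∀ k : ℕ,
    Tendsto (fun n => ∫ ω, (X n ω : ℝ) ^ k ∂(μ n)) atTop (𝓝 (∫ x : ℕ, (x : ℝ) ^ k ∂ν))

/-! ### The modified Poisson distributions -/

/-- `R_n = ∑ k! S(n,k)`, the number of preferential arrangements (weak orders) of `n` labeled
elements. For `n ≥ 1` the term `k = 0` vanishes; `R_0 = 1`. -/
def prefArr (n : ℕ) : ℕ :=
  ∑ k ∈ Finset.range (n + 1), k.factorial * Nat.stirlingSecond n k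

/-- `γ_0 = log 2`, `γ_d = 2 R_d (log 2)^(d+1) / d!` for `1 ≤ d < ∞`, and `γ_∞ = 1`. -/
def gam (d : ℕ∞) : ℝ :=
  if d = ⊤ then 1
  else if d = 0 then Real.log 2
  else 2 * prefArr d.toNat * Real.log 2 ^ (d.toNat + 1) / d.toNat.factorial

/-- The point probabilities `P(X_d = ℓ)` of the modified Poisson distribution. -/
def modPoissonProb (d : ℕ∞) (l : ℕ) : ℝ :=
  if l = 0 then 1 - gam d / (2 * Real.log 2)
  else gam d * Real.log 2 ^ (l - 1) / (2 * l.factorial)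

/-- The modified Poisson distribution, i.e. the law of `X_d`, for `0 ≤ d ≤ ∞`. -/
def modPoisson (d : ℕ∞) : Measure ℕ :=
  Measure.sum fun l : ℕ => ENNReal.ofReal (modPoissonProb d l) • Measure.dirac l

/-! The facts below show that `modPoisson d` is a probability measure. -/

def surj (n k : ℕ) : ℕ := k.factorial * Nat.stirlingSecond n k

lemma surj_succ_succ (n k : ℕ) :
    surj (n + 1) (k + 1) = (k + 1) * (surj n k + surj n (k + 1)) := by
  simp only [surj, Nat.stirlingSecond_succ_succ, Nat.factorial_succ]
  ring

lemma surj_zero_right (n : ℕ) : surj (n + 1) 0 = 0 := by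
  simp [surj, Nat.stirlingSecond_succ_zero]

lemma sum_choose_surj (n k : ℕ) :
    ∑ j ∈ Finset.range (n + 1), n.choose j * surj j k = surj n k + surj n (k + 1) := by
  induction n generalizing k with
  | zero => simp [surj]
  | succ n ih =>
    have hP : ∑ j ∈ Finset.range (n + 2), (n + 1).choose j * surj j k
        = ∑ j ∈ Finset.range (n + 1), n.choose j * surj j k
          + ∑ j ∈ Finset.range (n + 1), n.choose j * surj (j + 1) k := by
      rw [Finset.sum_range_succ' _ (n + 1)]
      have h1 : ∑ j ∈ Finset.range (n + 1), n.choose j * surj j k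
          = ∑ j ∈ Finset.range (n + 1), n.choose (j + 1) * surj (j + 1) k + surj 0 k := by
        rw [Finset.sum_range_succ' _ n, Finset.sum_range_succ _ n]
        simp
      rw [h1]
      simp only [Nat.choose_succ_succ, add_mul, Finset.sum_add_distrib]
      simp
      ring
    rw [hP, ih k]
    cases k with
    | zero =>
      rw [surj_succ_succ]
      simp only [surj_zero_right, mul_zero, Finset.sum_const_zero]
      ring
    | succ k =>
      have h2 : ∑ j ∈ Finset.range (n + 1), n.choose j * surj (j + 1) (k + 1)
          = (k + 1) * (∑ j ∈ Finset.range (n + 1), n.choose j * surj j k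
            + ∑ j ∈ Finset.range (n + 1), n.choose j * surj j (k + 1)) := by
        rw [← Finset.sum_add_distrib, Finset.mul_sum]
        refine Finset.sum_congr rfl fun j _ => ?_
        rw [surj_succ_succ]
        ring
      rw [h2, ih k, ih (k + 1), surj_succ_succ, surj_succ_succ]
      ring

lemma surj_eq_zero {n k : ℕ} (h : n < k) : surj n k = 0 := by
  simp [surj, Nat.stirlingSecond_eq_zero_of_lt h]

lemma prefArr_eq {n m : ℕ} (h : n ≤ m) :
    prefArr n = ∑ k ∈ Finset.range (m + 1), surj n k := by
  unfold prefArr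
  refine Finset.sum_subset (Finset.range_mono (by omega)) fun k _ hk => ?_
  exact surj_eq_zero (by simpa using hk)

lemma prefArr_succ (n : ℕ) :
    prefArr (n + 1) = ∑ j ∈ Finset.range (n + 1), (n + 1).choose j * prefArr j := by
  have h1 : ∑ j ∈ Finset.range (n + 2), (n + 1).choose j * prefArr j
      = ∑ k ∈ Finset.range (n + 2), (surj (n + 1) k + surj (n + 1) (k + 1)) := by
    simp only [← sum_choose_surj]
    rw [Finset.sum_comm]
    refine Finset.sum_congr rfl fun j hj => ?_
    rw [prefArr_eq (show j ≤ n + 1 by simp at hj; omega), Finset.mul_sum]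
  rw [Finset.sum_range_succ, Finset.sum_add_distrib, ← prefArr_eq le_rfl] at h1
  have h2 : ∑ k ∈ Finset.range (n + 2), surj (n + 1) (k + 1) = prefArr (n + 1) := by
    rw [prefArr_eq (show n + 1 ≤ n + 2 by omega), Finset.sum_range_succ' _ (n + 2),
      surj_zero_right, add_zero]
  rw [h2] at h1
  simp at h1
  omega

lemma log_two_pos : 0 < Real.log 2 := Real.log_pos (by norm_num)

lemma hasSum_exp_log_two :
    HasSum (fun l : ℕ => Real.log 2 ^ (l + 1) / ((l + 1).factorial : ℝ)) 1 := by
  have h := NormedSpace.expSeries_div_hasSum_exp (𝔸 := ℝ) (Real.log 2)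
  rw [← Real.exp_eq_exp_ℝ, Real.exp_log (by norm_num)] at h
  rw [← hasSum_nat_add_iff' 1] at h
  have h2 : (2 : ℝ) - ∑ i ∈ Finset.range 1, Real.log 2 ^ i / (i.factorial : ℝ) = 1 := by
    norm_num
  rwa [h2] at h

lemma prefArr_bound (n : ℕ) :
    (prefArr n : ℝ) * Real.log 2 ^ n / n.factorial ≤ 1 := by
  induction n using Nat.strong_induction_on with
  | _ n ih =>
    cases n with
    | zero => simp [prefArr]
    | succ n =>
      have key : (prefArr (n + 1) : ℝ) * Real.log 2 ^ (n + 1) / (n + 1).factorial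
          = ∑ j ∈ Finset.range (n + 1), ((prefArr j : ℝ) * Real.log 2 ^ j / j.factorial)
            * (Real.log 2 ^ (n + 1 - j) / (n + 1 - j).factorial) := by
        rw [prefArr_succ]
        push_cast
        rw [Finset.sum_mul, Finset.sum_div]
        refine Finset.sum_congr rfl fun j hj => ?_
        have hj' : j ≤ n + 1 := by simp at hj; omega
        have hp : Real.log 2 ^ (n + 1) = Real.log 2 ^ j * Real.log 2 ^ (n + 1 - j) := by
          rw [← pow_add]
          congr 1
          omega
        rw [Nat.cast_choose ℝ hj', hp]
        have := (n + 1).factorial_ne_zero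
        have := j.factorial_ne_zero
        have := (n + 1 - j).factorial_ne_zero
        field_simp
      rw [key]
      calc _ ≤ ∑ j ∈ Finset.range (n + 1),
            (Real.log 2 ^ (n + 1 - j) / ((n + 1 - j).factorial : ℝ)) := by
            refine Finset.sum_le_sum fun j hj => ?_
            have h0 : 0 ≤ Real.log 2 ^ (n + 1 - j) / ((n + 1 - j).factorial : ℝ) := by
              have := log_two_pos
              positivity
            exact mul_le_of_le_one_left h0 (ih j (by simpa using hj))
        _ = ∑ l ∈ Finset.range (n + 1), (Real.log 2 ^ (l + 1) / ((l + 1).factorial : ℝ)) := by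
            rw [← Finset.sum_range_reflect]
            refine Finset.sum_congr rfl fun j hj => ?_
            have : n + 1 - (n + 1 - 1 - j) = j + 1 := by simp at hj; omega
            rw [this]
        _ ≤ 1 := by
            refine sum_le_hasSum _ (fun l _ => ?_) hasSum_exp_log_two
            have := log_two_pos
            positivity

lemma gam_nonneg (d : ℕ∞) : 0 ≤ gam d := by
  have := log_two_pos
  unfold gam
  split_ifs <;> positivity

lemma gam_le (d : ℕ∞) : gam d ≤ 2 * Real.log 2 := by
  have h0 := log_two_pos
  unfold gam
  split_ifs
  · have := Real.log_two_gt_d9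
    linarith
  · linarith
  · have h := prefArr_bound d.toNat
    calc _ = 2 * Real.log 2
          * ((prefArr d.toNat : ℝ) * Real.log 2 ^ d.toNat / d.toNat.factorial) := by ring
      _ ≤ 2 * Real.log 2 * 1 := by gcongr
      _ = _ := by ring

lemma modPoissonProb_nonneg (d : ℕ∞) (l : ℕ) : 0 ≤ modPoissonProb d l := by
  have h0 := log_two_pos
  have h1 := gam_nonneg d
  unfold modPoissonProb
  split_ifs
  · rw [sub_nonneg, div_le_one (by positivity)]
    exact gam_le d
  · positivity

lemma hasSum_modPoissonProb (d : ℕ∞) : HasSum (modPoissonProb d) 1 := by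
  rw [← hasSum_nat_add_iff' 1]
  have h := hasSum_exp_log_two.mul_left (gam d / (2 * Real.log 2))
  have h0 := log_two_pos
  have h1 : (fun l : ℕ => gam d / (2 * Real.log 2) * (Real.log 2 ^ (l + 1) / ((l + 1).factorial : ℝ)))
      = fun l => modPoissonProb d (l + 1) := by
    funext l
    simp only [modPoissonProb, Nat.add_one_ne_zero, if_false, Nat.add_sub_cancel]
    have := (l + 1).factorial_ne_zero
    rw [pow_succ]
    field_simp
  have h2 : gam d / (2 * Real.log 2) * 1 = 1 - ∑ i ∈ Finset.range 1, modPoissonProb d i := by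
    simp [modPoissonProb]
  rwa [h1, h2] at h

instance (d : ℕ∞) : IsProbabilityMeasure (modPoisson d) := by
  constructor
  rw [modPoisson, Measure.sum_apply _ MeasurableSet.univ]
  simp only [Measure.smul_apply, measure_univ, smul_eq_mul, mul_one]
  rw [← ENNReal.ofReal_tsum_of_nonneg (modPoissonProb_nonneg d) (hasSum_modPoissonProb d).summable,
    (hasSum_modPoissonProb d).tsum_eq, ENNReal.ofReal_one]

/-- The probability `1/2`, as the parameter of the geometric distribution `Ge(1/2)`,
`P(X = k) = 2^(-k-1)`, `k ≥ 0`. -/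
def half : unitInterval := ⟨1 / 2, by norm_num, by norm_num⟩

/-- The parameter `log 2` of the Poisson distribution. -/
def logTwo : NNReal := ⟨Real.log 2, Real.log_nonneg (by norm_num)⟩

end ThresholdGraph

end

open MeasureTheory ProbabilityTheory Filter Topology

noncomputable section

namespace ThresholdGraph

/-! ### Bounded harmonic functions of alternating lattice walks -/

/-! A threshold graph with at least two vertices has either isolated or dominating vertices, never
both. Deleting the isolated vertices and passing to complements thus takes it apart block by block.
The number of ways to restore a block of given size is one for unlabeled graphs and a binomial
coefficient for labeled ones (`PeelableClass`). Weighting graphs of order `n` by `2^(-n)`,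
respectively `(log 2)^n / n!`, turns block sizes into a probability law `p` whose mean `m` is `2`,
respectively `2 log 2` (`BlockLaw`). The weighted counts of graphs without isolated vertices then
have a positive limit (`BlockLaw.tendsto_renewal`).

Fix `l ≥ 1` and follow the pair (codegree `n - 1 - d`, degree `d`). Deleting `i` isolated vertices
lowers the codegree by `i`; complementation exchanges the two coordinates. Hence the weighted number
of graphs with isolated vertices and exactly `l` vertices of degree `d` is the expected payoff of a
walk in a quadrant with alternately horizontal and vertical jumps (`Peeling.eq_absorb`). The walk is
paid when the tracked degree reaches `0`: the `l` vertices are then an isolated block, worth `p l`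
times the weighted count of what remains.

Far from both axes, ultrafilter limits of the payoff under bounded shifts form a bounded alternating
harmonic function on the plane, and such functions are constant (`AltHarmonic.eq_const`). An exact
balance of exits from the quadrant (`sum_tail_absorb_eq_one`) fixes the constant: the limiting
payoff divided by `m` (`BlockLaw.tendsto_absorb`). So the probability of `l` vertices tends to `p l
/ m`. For fixed `d` the factor `1 / m` is replaced by the renewal probability `u d`, or by `1 / 2`
when `d = 0` (`BlockLaw.tendsto_absorb_fixed`). In the unlabeled case all these factors equal `1 /
2`, which is why every sequence `d` has the same limit; in the labeled case they are `γ_d / (2 log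
2)`.

The probabilities are eventually at most a constant times `p l` (`PeelableClass.exists_ratio_le`),
so dominated convergence yields convergence in law and of all moments. -/

lemma hasSum_of_eq {f g : ℕ → ℝ} {a : ℝ} (h : ∀ i, f i = g i) (hg : HasSum g a) : HasSum f a := by
  rwa [funext h]

/-- `p (i + 1)`, `i ≥ 0`, is a probability distribution with full support on the positive integers
and with mean `m`. -/
structure BlockLaw (p : ℕ → ℝ) (m : ℝ) : Prop where
  pos : ∀ i, 0 < p (i + 1)
  hasSum : HasSum (fun i => p (i + 1)) 1
  hasSum_mean : HasSum (fun i : ℕ => ((i : ℝ) + 1) * p (i + 1)) m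

/-- Alternating harmonicity in the plane: `h` averages `g` along horizontal jumps and `g` averages
`h` along vertical jumps. -/
structure AltHarmonic (p : ℕ → ℝ) (h g : ℤ → ℤ → ℝ) : Prop where
  left : ∀ k l, HasSum (fun i : ℕ => p (i + 1) * g (k - 1 - i) l) (h k l)
  right : ∀ k l, HasSum (fun i : ℕ => p (i + 1) * h k (l - 1 - i)) (g k l)

lemma AltHarmonic.neg {p : ℕ → ℝ} {h g : ℤ → ℤ → ℝ} (H : AltHarmonic p h g) :
    AltHarmonic p (fun k l => -h k l) (fun k l => -g k l) where
  left k l := by simpa using (H.left k l).neg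
  right k l := by simpa using (H.right k l).neg

lemma AltHarmonic.swap {p : ℕ → ℝ} {h g : ℤ → ℤ → ℝ} (H : AltHarmonic p h g) :
    AltHarmonic p (fun k l => g l k) (fun k l => h l k) where
  left k l := H.right l k
  right k l := H.left l k

/-- An average that is close to an upper bound forces each term to be close to it. -/
lemma BlockLaw.sub_le_of_hasSum {p : ℕ → ℝ} {m : ℝ} (hp : BlockLaw p m) {D : ℕ → ℝ} {s d : ℝ}
    (hD : ∀ i, D i ≤ s) (hsum : HasSum (fun i => p (i + 1) * D i) d) (j : ℕ) :
    p (j + 1) * (s - D j) ≤ s - d := by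
  have h1 : HasSum (fun i => p (i + 1) * (s - D i)) (s - d) := by
    have h := (hp.hasSum.mul_right s).sub hsum
    simp only [one_mul] at h
    exact hasSum_of_eq (fun i => by ring) h
  exact le_hasSum h1 j fun i _ => mul_nonneg (hp.pos i).le (sub_nonneg.2 (hD i))

/-- A maximum principle for horizontal increments, which obey the same averaging. If their supremum
`s` were positive, a point nearly attaining it would force many consecutive increments to its left
to be at least `s / 2`, and their telescoping sum would contradict boundedness. -/
lemma AltHarmonic.sub_le {p : ℕ → ℝ} {m : ℝ} (hp : BlockLaw p m) {h g : ℤ → ℤ → ℝ}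
    (H : AltHarmonic p h g) {M : ℝ} (hM : ∀ k l, |h k l| ≤ M) (gM : ∀ k l, |g k l| ≤ M) :
    (∀ k l, h k l - h (k - 1) l ≤ 0) ∧ (∀ k l, g k l - g (k - 1) l ≤ 0) := by
  set Dh : ℤ → ℤ → ℝ := fun k l => h k l - h (k - 1) l with hDh
  set Dg : ℤ → ℤ → ℝ := fun k l => g k l - g (k - 1) l with hDg
  have hl : ∀ k l, HasSum (fun i : ℕ => p (i + 1) * Dg (k - 1 - i) l) (Dh k l) := by
    intro k l
    have h1 := (H.left k l).sub (H.left (k - 1) l)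
    refine hasSum_of_eq (fun i => ?_) h1
    simp only [hDg]
    rw [show k - 1 - 1 - (i : ℤ) = k - 1 - i - 1 by ring]
    ring
  have hr : ∀ k l, HasSum (fun i : ℕ => p (i + 1) * Dh k (l - 1 - i)) (Dg k l) := by
    intro k l
    have h1 := (H.right k l).sub (H.right (k - 1) l)
    refine hasSum_of_eq (fun i => ?_) h1
    simp only [hDh]
    ring
  set S : Set ℝ := {t | ∃ k l, t = Dh k l ∨ t = Dg k l} with hS
  have hbdd : BddAbove S := by
    refine ⟨2 * M, ?_⟩
    rintro t ⟨k, l, rfl | rfl⟩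
    · have := abs_le.1 (hM k l); have := abs_le.1 (hM (k - 1) l); simp only [hDh]; linarith
    · have := abs_le.1 (gM k l); have := abs_le.1 (gM (k - 1) l); simp only [hDg]; linarith
  have hne : S.Nonempty := ⟨_, 0, 0, Or.inl rfl⟩
  set s := sSup S with hs
  have hDhs : ∀ k l, Dh k l ≤ s := fun k l => le_csSup hbdd ⟨k, l, Or.inl rfl⟩
  have hDgs : ∀ k l, Dg k l ≤ s := fun k l => le_csSup hbdd ⟨k, l, Or.inr rfl⟩
  suffices s ≤ 0 from ⟨fun k l => (hDhs k l).trans this, fun k l => (hDgs k l).trans this⟩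
  by_contra! hpos
  -- values of `Dh` are arbitrarily close to the supremum
  have hclose : ∀ ε > 0, ∃ k l, s - Dh k l < ε := by
    intro ε hε
    have hε' : 0 < min ε (p 1 * ε) := lt_min hε (mul_pos (hp.pos 0) hε)
    obtain ⟨t, ⟨k, l, ht⟩, hlt⟩ := exists_lt_of_lt_csSup hne
      (show s - min ε (p 1 * ε) < sSup S by rw [← hs]; linarith)
    rcases ht with rfl | rfl
    · exact ⟨k, l, by have := min_le_left ε (p 1 * ε); linarith⟩
    · refine ⟨k, l - 1 - (0 : ℕ), ?_⟩
      have h1 := hp.sub_le_of_hasSum (fun i => hDhs k (l - 1 - i)) (hr k l) 0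
      have h2 := min_le_right ε (p 1 * ε)
      have h3 : p 1 * (s - Dh k (l - 1 - (0 : ℕ))) < p 1 * ε := by
        have : p (0 + 1) = p 1 := rfl
        rw [this] at h1
        linarith
      exact lt_of_mul_lt_mul_left h3 (hp.pos 0).le
  -- `N` increments of size `s / 2` exceed `2 * M`, the largest possible oscillation of `g`.
  obtain ⟨N, hN⟩ := exists_nat_gt (2 * M / (s / 2))
  have hN' : 2 * M < N * (s / 2) := by rwa [div_lt_iff₀ (by linarith)] at hN
  -- Full support of `p` gives one `ε` for the first `N` terms: an average within `ε` of `s` leaves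
  -- each of them a deficit of at most `s / 2`.
  obtain ⟨ε, hε, hεp⟩ : ∃ ε > 0, ∀ i ∈ Finset.range N, ε ≤ p (i + 1) * (s / 2) := by
    clear hN hN'
    induction N with
    | zero => exact ⟨1, one_pos, by simp⟩
    | succ N ih =>
      obtain ⟨ε, hε, h⟩ := ih
      refine ⟨min ε (p (N + 1) * (s / 2)), lt_min hε (mul_pos (hp.pos N) (by linarith)), ?_⟩
      intro i hi
      rw [Finset.mem_range, Nat.lt_succ_iff_lt_or_eq] at hi
      rcases hi with hi | rfl
      · exact (min_le_left _ _).trans (h i (Finset.mem_range.2 hi))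
      · exact min_le_right _ _
  obtain ⟨k, l, hkl⟩ := hclose ε hε
  have hge : ∀ i ∈ Finset.range N, s / 2 ≤ Dg (k - 1 - i) l := by
    intro i hi
    have h1 := hp.sub_le_of_hasSum (fun i => hDgs (k - 1 - i) l) (hl k l) i
    have h2 : p (i + 1) * (s - Dg (k - 1 - i) l) < p (i + 1) * (s / 2) := by
      linarith [hεp i hi]
    have := lt_of_mul_lt_mul_left h2 (hp.pos i).le
    linarith
  have htel : ∑ i ∈ Finset.range N, Dg (k - 1 - i) l = g (k - 1) l - g (k - 1 - N) l := by
    have := Finset.sum_range_sub' (fun i : ℕ => g (k - 1 - i) l) N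
    simp only [Nat.cast_zero, sub_zero] at this
    rw [← this]
    refine Finset.sum_congr rfl fun i _ => ?_
    simp only [hDg]
    push_cast
    rw [show k - 1 - (i : ℤ) - 1 = k - 1 - (i + 1) by ring]
  have h1 := Finset.sum_le_sum hge
  rw [htel, Finset.sum_const, Finset.card_range, nsmul_eq_mul] at h1
  have := abs_le.1 (gM (k - 1) l)
  have := abs_le.1 (gM (k - 1 - N) l)
  linarith

/-- Bounded alternating harmonic functions are constant. -/
lemma AltHarmonic.eq_const {p : ℕ → ℝ} {m : ℝ} (hp : BlockLaw p m) {h g : ℤ → ℤ → ℝ}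
    (H : AltHarmonic p h g) {M : ℝ} (hM : ∀ k l, |h k l| ≤ M) (gM : ∀ k l, |g k l| ≤ M) :
    ∃ c, ∀ k l, h k l = c ∧ g k l = c := by
  -- One-sided bounds for the pair, its negative and the coordinate swaps of both make all
  -- increments of `h` vanish.
  have h1 := H.sub_le hp hM gM
  have h2 := H.neg.sub_le hp (fun k l => by simpa using hM k l) (fun k l => by simpa using gM k l)
  have h3 := H.swap.sub_le hp (fun k l => gM l k) (fun k l => hM l k)
  have h4 := H.neg.swap.sub_le hp (fun k l => by simpa using gM l k)
    (fun k l => by simpa using hM l k)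
  have hx : ∀ k l, h k l = h (k - 1) l := fun k l => by
    have := h1.1 k l; have := h2.1 k l; linarith
  have hy : ∀ k l, h k l = h k (l - 1) := fun k l => by
    have := h3.2 l k; have := h4.2 l k; linarith
  have hx0 : ∀ k l, h k l = h 0 l := fun k l => by
    induction k using Int.induction_on with
    | zero => rfl
    | succ n ih => rw [hx, ← ih]; congr 1; ring
    | pred n ih => rw [← ih, hx (-n)]
  have hy0 : ∀ k l, h k l = h k 0 := fun k l => by
    induction l using Int.induction_on with
    | zero => rfl
    | succ n ih => rw [hy, ← ih]; congr 1; ring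
    | pred n ih => rw [← ih, hy k (-n)]
  have hc : ∀ k l, h k l = h 0 0 := fun k l => by rw [hx0, hy0]
  refine ⟨h 0 0, fun k l => ⟨hc k l, ?_⟩⟩
  have h5 := H.right k l
  simp only [hc] at h5
  have h6 := hp.hasSum.mul_right (h 0 0)
  rw [one_mul] at h6
  exact h5.unique h6

/-! ### Convolutions along filters -/

/-- Dominated convergence with bound `r i * M`. It carries the finite averaging sums in the quadrant
over to full averages under the block law. -/
lemma tendsto_sum_range_mul {ι : Type*} {f : Filter ι} {r : ℕ → ℝ} (hr : Summable r)
    (hr0 : ∀ i, 0 ≤ r i) {X : ι → ℕ} (hX : Tendsto X f atTop) {F : ι → ℕ → ℝ} {c : ℕ → ℝ} {M : ℝ}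
    (hF : ∀ n i, |F n i| ≤ M) (hc : ∀ i, Tendsto (fun n => F n i) f (𝓝 (c i))) :
    Tendsto (fun n => ∑ i ∈ Finset.range (X n), r i * F n i) f (𝓝 (∑' i, r i * c i)) := by
  have h1 : ∀ n, ∑ i ∈ Finset.range (X n), r i * F n i
      = ∑' i, if i < X n then r i * F n i else 0 := by
    intro n
    rw [tsum_eq_sum (s := Finset.range (X n))]
    · exact Finset.sum_congr rfl fun i hi => by rw [if_pos (Finset.mem_range.1 hi)]
    · intro i hi
      rw [if_neg (by simpa using hi)]
  simp only [h1]
  refine tendsto_tsum_of_dominated_convergence (bound := fun i => r i * M) (hr.mul_right M) ?_ ?_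
  · intro i
    refine ((hc i).const_mul (r i)).congr' ?_
    filter_upwards [hX.eventually_gt_atTop i] with n hn
    rw [if_pos hn]
  · refine Eventually.of_forall fun n i => ?_
    have hM : 0 ≤ M := (abs_nonneg _).trans (hF n i)
    split_ifs
    · rw [Real.norm_eq_abs, abs_mul, abs_of_nonneg (hr0 i)]
      exact mul_le_mul_of_nonneg_left (hF n i) (hr0 i)
    · simpa using mul_nonneg (hr0 i) hM

lemma tendsto_toNat_add {ι : Type*} {f : Filter ι} {x : ι → ℕ} (hx : Tendsto x f atTop) (k : ℤ) :
    Tendsto (fun n => ((x n : ℤ) + k).toNat) f atTop := by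
  refine tendsto_atTop.2 fun b => ?_
  filter_upwards [hx.eventually_ge_atTop (b + k.natAbs)] with n hn
  omega

/-- Two bounded arrays that approximately average each other have, along an ultrafilter, a common
limit that does not depend on bounded shifts. -/
lemma exists_shift_limit {p : ℕ → ℝ} {m : ℝ} (hp : BlockLaw p m) {ι : Type*} (f : Ultrafilter ι)
    {x y : ι → ℕ} (hx : Tendsto x f atTop) (hy : Tendsto y f atTop) {A B : ℕ → ℕ → ℝ} {M : ℝ}
    (hA : ∀ x y, |A x y| ≤ M) (hB : ∀ x y, |B x y| ≤ M) {ε : ℕ → ℝ} (hε : Tendsto ε atTop (𝓝 0))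
    (hAB : ∀ x y, 1 ≤ x → 1 ≤ y →
      |A x y - ∑ i ∈ Finset.range x, p (i + 1) * B (x - 1 - i) y| ≤ ε x)
    (hBA : ∀ x y, 1 ≤ x → 1 ≤ y →
      |B x y - ∑ i ∈ Finset.range y, p (i + 1) * A x (y - 1 - i)| ≤ ε y) :
    ∃ c, ∀ k l : ℤ,
      Tendsto (fun n => A ((x n : ℤ) + k).toNat ((y n : ℤ) + l).toNat) f (𝓝 c) ∧
      Tendsto (fun n => B ((x n : ℤ) + k).toNat ((y n : ℤ) + l).toNat) f (𝓝 c) := by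
  have hex : ∀ (A : ℕ → ℕ → ℝ), (∀ x y, |A x y| ≤ M) → ∀ k l : ℤ, ∃ c, |c| ≤ M ∧
      Tendsto (fun n => A ((x n : ℤ) + k).toNat ((y n : ℤ) + l).toNat) f (𝓝 c) := by
    intro A hA k l
    -- By compactness of `[-M, M]` every shifted array converges along the same ultrafilter, so no
    -- diagonal extraction of subsequences is needed.
    obtain ⟨c, hc, hle⟩ := (isCompact_Icc (a := -M) (b := M)).ultrafilter_le_nhds
      (f.map fun n => A ((x n : ℤ) + k).toNat ((y n : ℤ) + l).toNat)
      (by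
        rw [le_principal_iff]
        exact Filter.mem_map.2 (Filter.univ_mem' fun n => abs_le.1 (hA _ _)))
    exact ⟨c, abs_le.2 hc, hle⟩
  choose h hhM hh using hex A hA
  choose g hgM hg using hex B hB
  have hps : Summable fun i => p (i + 1) := hp.hasSum.summable
  have hsum : ∀ c : ℕ → ℝ, (∀ i, |c i| ≤ M) → Summable fun i => p (i + 1) * c i := by
    intro c hc
    refine Summable.of_norm_bounded (hps.mul_right M) fun i => ?_
    rw [Real.norm_eq_abs, abs_mul, abs_of_pos (hp.pos i)]
    exact mul_le_mul_of_nonneg_left (hc i) (hp.pos i).le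
  -- Far out, `toNat` truncates nothing and the error `ε` vanishes, so approximate averaging becomes
  -- exact in the limit.
  have key : AltHarmonic p h g := by
    constructor
    · intro k l
      have hX := tendsto_toNat_add hx k
      have hY := tendsto_toNat_add hy l
      have h1 := tendsto_sum_range_mul hps (fun i => (hp.pos i).le) hX
        (F := fun n i => B (((x n : ℤ) + k).toNat - 1 - i) ((y n : ℤ) + l).toNat) (M := M)
        (c := fun i => g (k - 1 - i) l) (fun n i => hB _ _) (fun i => by
          refine (hg (k - 1 - i) l).congr' ?_
          filter_upwards [hX.eventually_gt_atTop (i + 1)] with n hn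
          congr 1
          omega)
      have h2 : Tendsto (fun n => A ((x n : ℤ) + k).toNat ((y n : ℤ) + l).toNat
          - ∑ i ∈ Finset.range ((x n : ℤ) + k).toNat,
            p (i + 1) * B (((x n : ℤ) + k).toNat - 1 - i) ((y n : ℤ) + l).toNat) f (𝓝 0) := by
        refine squeeze_zero_norm' ?_ (hε.comp hX)
        filter_upwards [hX.eventually_ge_atTop 1, hY.eventually_ge_atTop 1] with n h3 h4
        exact hAB _ _ h3 h4
      have h3 := h2.add h1
      simp only [sub_add_cancel, zero_add] at h3
      rw [tendsto_nhds_unique (hh k l) h3]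
      exact (hsum _ fun i => hgM _ _).hasSum
    · intro k l
      have hX := tendsto_toNat_add hx k
      have hY := tendsto_toNat_add hy l
      have h1 := tendsto_sum_range_mul hps (fun i => (hp.pos i).le) hY
        (F := fun n i => A ((x n : ℤ) + k).toNat (((y n : ℤ) + l).toNat - 1 - i)) (M := M)
        (c := fun i => h k (l - 1 - i)) (fun n i => hA _ _) (fun i => by
          refine (hh k (l - 1 - i)).congr' ?_
          filter_upwards [hY.eventually_gt_atTop (i + 1)] with n hn
          congr 1
          omega)
      have h2 : Tendsto (fun n => B ((x n : ℤ) + k).toNat ((y n : ℤ) + l).toNat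
          - ∑ i ∈ Finset.range ((y n : ℤ) + l).toNat,
            p (i + 1) * A ((x n : ℤ) + k).toNat (((y n : ℤ) + l).toNat - 1 - i)) f (𝓝 0) := by
        refine squeeze_zero_norm' ?_ (hε.comp hY)
        filter_upwards [hX.eventually_ge_atTop 1, hY.eventually_ge_atTop 1] with n h3 h4
        exact hBA _ _ h3 h4
      have h3 := h2.add h1
      simp only [sub_add_cancel, zero_add] at h3
      rw [tendsto_nhds_unique (hg k l) h3]
      exact (hsum _ fun i => hhM _ _).hasSum
  obtain ⟨c, hc⟩ := key.eq_const hp hhM hgM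
  exact ⟨c, fun k l => ⟨(hc k l).1 ▸ hh k l, (hc k l).2 ▸ hg k l⟩⟩

/-! ### Tails of the block law -/

/-- The tail `P(block > k)`. -/
def tail (p : ℕ → ℝ) (k : ℕ) : ℝ := 1 - ∑ i ∈ Finset.range k, p (i + 1)

lemma tail_zero (p : ℕ → ℝ) : tail p 0 = 1 := by simp [tail]

lemma tail_succ (p : ℕ → ℝ) (k : ℕ) : tail p (k + 1) = tail p k - p (k + 1) := by
  simp only [tail, Finset.sum_range_succ]
  ring

lemma BlockLaw.hasSum_tail_term {p : ℕ → ℝ} {m : ℝ} (hp : BlockLaw p m) (k : ℕ) :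
    HasSum (fun i => p (i + k + 1)) (tail p k) := by
  have := (hasSum_nat_add_iff' (f := fun i => p (i + 1)) k).2 hp.hasSum
  exact this

lemma BlockLaw.tail_nonneg {p : ℕ → ℝ} {m : ℝ} (hp : BlockLaw p m) (k : ℕ) : 0 ≤ tail p k :=
  (hp.hasSum_tail_term k).nonneg fun _ => (hp.pos _).le

lemma BlockLaw.tail_le_one {p : ℕ → ℝ} {m : ℝ} (hp : BlockLaw p m) (k : ℕ) : tail p k ≤ 1 :=
  sub_le_self _ (Finset.sum_nonneg fun _ _ => (hp.pos _).le)

lemma BlockLaw.tendsto_tail {p : ℕ → ℝ} {m : ℝ} (hp : BlockLaw p m) :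
    Tendsto (tail p) atTop (𝓝 0) := by
  have := hp.hasSum.tendsto_sum_nat.const_sub 1
  rwa [sub_self] at this

lemma BlockLaw.hasSum_tail {p : ℕ → ℝ} {m : ℝ} (hp : BlockLaw p m) : HasSum (tail p) m := by
  rw [hasSum_iff_tendsto_nat_of_nonneg hp.tail_nonneg]
  -- Summation by parts; the boundary term is at most a tail of the series for the mean.
  have h1 : ∀ N : ℕ, ∑ k ∈ Finset.range N, tail p k
      = ∑ i ∈ Finset.range N, ((i : ℝ) + 1) * p (i + 1) + N * tail p N := by
    intro N
    induction N with
    | zero => simp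
    | succ N ih =>
      rw [Finset.sum_range_succ, ih, Finset.sum_range_succ, tail_succ]
      push_cast
      ring
  have h2 : Tendsto (fun N : ℕ => (N : ℝ) * tail p N) atTop (𝓝 0) := by
    have h3 := hp.hasSum_mean.tendsto_sum_nat.const_sub m
    rw [sub_self] at h3
    refine squeeze_zero (fun N => mul_nonneg N.cast_nonneg (hp.tail_nonneg N)) (fun N => ?_) h3
    have h4 := (hasSum_nat_add_iff' (f := fun i : ℕ => ((i : ℝ) + 1) * p (i + 1)) N).2
      hp.hasSum_mean
    refine hasSum_le (fun i => ?_) ((hp.hasSum_tail_term N).mul_left (N : ℝ)) h4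
    have := (hp.pos (i + N)).le
    push_cast
    exact mul_le_mul_of_nonneg_right (by linarith [(Nat.cast_nonneg i : (0 : ℝ) ≤ i)]) this
  simp only [h1]
  simpa using hp.hasSum_mean.tendsto_sum_nat.add h2

lemma BlockLaw.mean_pos {p : ℕ → ℝ} {m : ℝ} (hp : BlockLaw p m) : 0 < m := by
  have := le_hasSum hp.hasSum_tail 0 fun i _ => hp.tail_nonneg i
  rw [tail_zero] at this
  linarith

lemma BlockLaw.sum_le_one {p : ℕ → ℝ} {m : ℝ} (hp : BlockLaw p m) (x : ℕ) :
    ∑ i ∈ Finset.range x, p (i + 1) ≤ 1 :=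
  sum_le_hasSum _ (fun _ _ => (hp.pos _).le) hp.hasSum

lemma BlockLaw.abs_sum_le {p : ℕ → ℝ} {m : ℝ} (hp : BlockLaw p m) {M : ℝ} (hM : 0 ≤ M)
    {x : ℕ} {b : ℕ → ℝ} (hb : ∀ i < x, |b i| ≤ M) :
    |∑ i ∈ Finset.range x, p (i + 1) * b i| ≤ M := by
  calc _ ≤ ∑ i ∈ Finset.range x, |p (i + 1) * b i| := Finset.abs_sum_le_sum_abs _ _
    _ ≤ ∑ i ∈ Finset.range x, p (i + 1) * M := by
      refine Finset.sum_le_sum fun i hi => ?_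
      rw [abs_mul, abs_of_pos (hp.pos i)]
      exact mul_le_mul_of_nonneg_left (hb i (Finset.mem_range.1 hi)) (hp.pos i).le
    _ ≤ 1 * M := by
      rw [← Finset.sum_mul]
      exact mul_le_mul_of_nonneg_right (hp.sum_le_one x) hM
    _ = M := one_mul M

/-! ### Absorption of an alternating walk in a quadrant -/

/-- The expected payoff of a walk in the quadrant that starts at `(x, y)` and makes alternately
horizontal and vertical jumps towards the axes with law `p`, the next one being horizontal. It
receives `φ` when it hits the horizontal axis, `ψ` when it hits the vertical axis, and nothing if
it jumps over an axis. -/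
def absorb (p : ℕ → ℝ) : (ℕ → ℝ) → (ℕ → ℝ) → ℕ → ℕ → ℝ
  | φ, _, x, 0 => φ x
  | φ, ψ, x, y + 1 => ∑ i : Fin x, p (i + 1) * absorb p ψ φ (y + 1) (x - 1 - i)
termination_by _ _ x y => x + y

section absorb

variable {p : ℕ → ℝ} {m : ℝ}

lemma absorb_zero (φ ψ : ℕ → ℝ) (x : ℕ) : absorb p φ ψ x 0 = φ x := by
  rw [absorb]

lemma absorb_of_pos (φ ψ : ℕ → ℝ) (x : ℕ) {y : ℕ} (hy : 1 ≤ y) :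
    absorb p φ ψ x y = ∑ i ∈ Finset.range x, p (i + 1) * absorb p ψ φ y (x - 1 - i) := by
  obtain ⟨y, rfl⟩ := Nat.exists_eq_add_of_le' hy
  rw [absorb, Finset.sum_range]

lemma absorb_zero_left (φ ψ : ℕ → ℝ) {y : ℕ} (hy : 1 ≤ y) : absorb p φ ψ 0 y = 0 := by
  rw [absorb_of_pos φ ψ 0 hy, Finset.sum_range_zero]

lemma absorb_add (φ₁ ψ₁ φ₂ ψ₂ : ℕ → ℝ) (x y : ℕ) :
    absorb p (fun k => φ₁ k + φ₂ k) (fun k => ψ₁ k + ψ₂ k) x y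
      = absorb p φ₁ ψ₁ x y + absorb p φ₂ ψ₂ x y := by
  induction h : x + y using Nat.strong_induction_on generalizing x y φ₁ ψ₁ φ₂ ψ₂ with
  | _ n ih =>
    rcases Nat.eq_zero_or_pos y with rfl | hy
    · simp only [absorb_zero]
    · simp only [absorb_of_pos _ _ x hy, ← Finset.sum_add_distrib, ← mul_add]
      refine Finset.sum_congr rfl fun i hi => ?_
      rw [Finset.mem_range] at hi
      rw [ih (y + (x - 1 - i)) (by omega) _ _ _ _ _ _ rfl]

lemma absorb_const_mul (c : ℝ) (φ ψ : ℕ → ℝ) (x y : ℕ) :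
    absorb p (fun k => c * φ k) (fun k => c * ψ k) x y = c * absorb p φ ψ x y := by
  induction h : x + y using Nat.strong_induction_on generalizing x y φ ψ with
  | _ n ih =>
    rcases Nat.eq_zero_or_pos y with rfl | hy
    · simp only [absorb_zero]
    · simp only [absorb_of_pos _ _ x hy, Finset.mul_sum]
      refine Finset.sum_congr rfl fun i hi => ?_
      rw [Finset.mem_range] at hi
      rw [ih (y + (x - 1 - i)) (by omega) _ _ _ _ rfl]
      ring

lemma BlockLaw.abs_absorb_le (hp : BlockLaw p m) {M : ℝ} {φ ψ : ℕ → ℝ} (hφ : ∀ k, |φ k| ≤ M)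
    (hψ : ∀ k, |ψ k| ≤ M) (x y : ℕ) : |absorb p φ ψ x y| ≤ M := by
  induction h : x + y using Nat.strong_induction_on generalizing x y φ ψ with
  | _ n ih =>
    rcases Nat.eq_zero_or_pos y with rfl | hy
    · simpa only [absorb_zero] using hφ x
    · rw [absorb_of_pos _ _ x hy]
      exact hp.abs_sum_le ((abs_nonneg _).trans (hφ 0)) fun i hi =>
        ih (y + (x - 1 - i)) (by omega) hψ hφ _ _ rfl

lemma BlockLaw.abs_absorb_le_absorb (hp : BlockLaw p m) {φ ψ φ' ψ' : ℕ → ℝ}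
    (hφ : ∀ k, |φ k| ≤ φ' k) (hψ : ∀ k, |ψ k| ≤ ψ' k) (x y : ℕ) :
    |absorb p φ ψ x y| ≤ absorb p φ' ψ' x y := by
  induction h : x + y using Nat.strong_induction_on generalizing x y φ ψ φ' ψ' with
  | _ n ih =>
    rcases Nat.eq_zero_or_pos y with rfl | hy
    · simpa only [absorb_zero] using hφ x
    · rw [absorb_of_pos _ _ x hy, absorb_of_pos _ _ x hy]
      refine (Finset.abs_sum_le_sum_abs _ _).trans (Finset.sum_le_sum fun i hi => ?_)
      rw [Finset.mem_range] at hi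
      rw [abs_mul, abs_of_pos (hp.pos i)]
      exact mul_le_mul_of_nonneg_left (ih (y + (x - 1 - i)) (by omega) hψ hφ _ _ rfl)
        (hp.pos i).le

/-- Induction on `x + y`. The origin carries no boundary condition but is never reached: a jump
changes one coordinate while the other is positive. -/
lemma eq_absorb {a : ℕ → ℕ → ℝ} {φ : ℕ → ℝ} (h0 : ∀ x, 1 ≤ x → a x 0 = φ x)
    (hrec : ∀ x y, 1 ≤ y → a x y = ∑ i ∈ Finset.range x, p (i + 1) * a y (x - 1 - i))
    (x y : ℕ) (hxy : 1 ≤ x + y) : a x y = absorb p φ φ x y := by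
  induction h : x + y using Nat.strong_induction_on generalizing x y with
  | _ n ih =>
    rcases Nat.eq_zero_or_pos y with rfl | hy
    · rw [absorb_zero, h0 x (by omega)]
    · rw [hrec x y hy, absorb_of_pos _ _ x hy]
      refine Finset.sum_congr rfl fun i hi => ?_
      rw [Finset.mem_range] at hi
      rw [ih (y + (x - 1 - i)) (by omega) _ _ (by omega) rfl]

lemma BlockLaw.exists_absorb_shift_limit (hp : BlockLaw p m) {ι : Type*} (f : Ultrafilter ι)
    {x y : ι → ℕ} (hx : Tendsto x f atTop) (hy : Tendsto y f atTop) {M : ℝ} {φ ψ : ℕ → ℝ}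
    (hφ : ∀ k, |φ k| ≤ M) (hψ : ∀ k, |ψ k| ≤ M) :
    ∃ c, ∀ k l : ℤ,
      Tendsto (fun n => absorb p φ ψ ((x n : ℤ) + k).toNat ((y n : ℤ) + l).toNat) f (𝓝 c) ∧
      Tendsto (fun n => absorb p ψ φ ((y n : ℤ) + l).toNat ((x n : ℤ) + k).toNat) f (𝓝 c) := by
  -- Averaging is exact here, so the error is zero. The arguments of `B` are swapped because
  -- `absorb` lists first the coordinate of the pending jump.
  refine exists_shift_limit hp f hx hy (A := absorb p φ ψ) (B := fun x y => absorb p ψ φ y x)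
    (M := M) (ε := fun _ => 0) (hp.abs_absorb_le hφ hψ) (fun x y => hp.abs_absorb_le hψ hφ y x)
    tendsto_const_nhds ?_ ?_
  · intro x y _ hy
    rw [absorb_of_pos φ ψ x hy, sub_self, abs_zero]
  · intro x y hx _
    rw [absorb_of_pos ψ φ y hx, sub_self, abs_zero]

/-- The sum of the absorption payoffs over an antidiagonal is at most the total payoff. -/
lemma BlockLaw.sum_antidiagonal_absorb_le (hp : BlockLaw p m) {φ : ℕ → ℝ} (hφ : ∀ k, 0 ≤ φ k)
    (n : ℕ) : ∑ x ∈ Finset.range (n + 1), absorb p φ φ x (n - x)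
      ≤ ∑ k ∈ Finset.range (n + 1), φ k := by
  have h0 : ∀ x y, 0 ≤ absorb p φ φ x y := fun x y =>
    (abs_nonneg _).trans (hp.abs_absorb_le_absorb (fun k => (abs_of_nonneg (hφ k)).le)
      (fun k => (abs_of_nonneg (hφ k)).le) x y)
  induction n using Nat.strong_induction_on with
  | _ n ih =>
    rw [Finset.sum_range_succ, Finset.sum_range_succ _ n, Nat.sub_self, absorb_zero]
    refine add_le_add_left ?_ _
    -- Grouping by the size of the first jump makes the inner sums parts of shorter antidiagonals,
    -- to which induction applies; the weights `p (i + 1)` sum to at most one.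
    calc ∑ x ∈ Finset.range n, absorb p φ φ x (n - x)
        = ∑ x ∈ Finset.Ico 0 n, ∑ i ∈ Finset.Ico 0 x,
          p (i + 1) * absorb p φ φ (n - x) (x - 1 - i) := by
          rw [← Finset.range_eq_Ico]
          refine Finset.sum_congr rfl fun x hx => ?_
          rw [Finset.mem_range] at hx
          rw [absorb_of_pos φ φ x (by omega), Finset.range_eq_Ico]
      _ = ∑ i ∈ Finset.range n, p (i + 1) * ∑ x ∈ Finset.Ico (i + 1) n,
          absorb p φ φ (n - x) (n - 1 - i - (n - x)) := by
          simp only [Finset.mul_sum]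
          rw [Finset.range_eq_Ico, Finset.sum_sigma', Finset.sum_sigma']
          refine Finset.sum_bij' (fun a _ => ⟨a.2, a.1⟩) (fun a _ => ⟨a.2, a.1⟩) ?_ ?_ ?_ ?_ ?_
          · rintro ⟨a, b⟩ h
            simp only [Finset.mem_sigma, Finset.mem_Ico] at h ⊢
            omega
          · rintro ⟨a, b⟩ h
            simp only [Finset.mem_sigma, Finset.mem_Ico] at h ⊢
            omega
          · intros; rfl
          · intros; rfl
          · rintro ⟨a, b⟩ h
            simp only [Finset.mem_sigma, Finset.mem_Ico] at h
            have : a - 1 - b = n - 1 - b - (n - a) := by omega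
            simp only [this]
      _ ≤ ∑ i ∈ Finset.range n, p (i + 1) * ∑ k ∈ Finset.range n, φ k := by
          refine Finset.sum_le_sum fun i hi => mul_le_mul_of_nonneg_left ?_ (hp.pos i).le
          rw [Finset.mem_range] at hi
          have h1 := ih (n - 1 - i) (by omega)
          refine le_trans ?_ (h1.trans (Finset.sum_le_sum_of_subset_of_nonneg
            (Finset.range_mono (by omega)) fun k _ _ => hφ k))
          rw [← Finset.sum_image (s := Finset.Ico (i + 1) n) (g := fun x => n - x)
            (f := fun z => absorb p φ φ z (n - 1 - i - z))]
          · refine Finset.sum_le_sum_of_subset_of_nonneg ?_ fun _ _ _ => h0 _ _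
            intro z hz
            simp only [Finset.mem_image, Finset.mem_Ico, Finset.mem_range] at hz ⊢
            omega
          · intro a ha b hb hab
            simp only [Finset.coe_Ico, Set.mem_Ico] at ha hb hab
            omega
      _ ≤ 1 * ∑ k ∈ Finset.range n, φ k := by
          rw [← Finset.sum_mul]
          exact mul_le_mul_of_nonneg_right (hp.sum_le_one n) (Finset.sum_nonneg fun k _ => hφ k)
      _ = _ := one_mul _

/-- Neighbouring points of one antidiagonal share the same ultrafilter limit, while the whole
antidiagonal carries at most `K`. So every multiple of the limit is at most `K`. -/
lemma BlockLaw.tendsto_absorb_zero_of_bounded_sum (hp : BlockLaw p m) {ι : Type*} {f : Filter ι}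
    {x y : ι → ℕ} (hx : Tendsto x f atTop) (hy : Tendsto y f atTop) {φ : ℕ → ℝ}
    (hφ : ∀ k, 0 ≤ φ k) {K : ℝ} (hK : ∀ n, ∑ k ∈ Finset.range n, φ k ≤ K) :
    Tendsto (fun n => absorb p φ φ (x n) (y n)) f (𝓝 0) := by
  have h0 : ∀ x y, 0 ≤ absorb p φ φ x y := fun x y =>
    (abs_nonneg _).trans (hp.abs_absorb_le_absorb (fun k => (abs_of_nonneg (hφ k)).le)
      (fun k => (abs_of_nonneg (hφ k)).le) x y)
  have hφK : ∀ k, |φ k| ≤ K := fun k => by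
    rw [abs_of_nonneg (hφ k)]
    exact (Finset.single_le_sum (f := φ) (fun i _ => hφ i) (Finset.self_mem_range_succ k)).trans
      (hK (k + 1))
  rw [tendsto_iff_ultrafilter]
  intro 𝒰 h𝒰
  have hx' := hx.mono_left h𝒰
  have hy' := hy.mono_left h𝒰
  obtain ⟨c, hc⟩ := hp.exists_absorb_shift_limit 𝒰 hx' hy' hφK hφK
  have hmain : Tendsto (fun n => absorb p φ φ (x n) (y n)) 𝒰 (𝓝 c) := by
    simpa using (hc 0 0).1
  have hc0 : 0 ≤ c := ge_of_tendsto' hmain fun n => h0 _ _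
  have hN : ∀ N : ℕ, N * c ≤ K := by
    intro N
    have h1 : Tendsto (fun n => ∑ k ∈ Finset.range N,
        absorb p φ φ ((x n : ℤ) + k).toNat ((y n : ℤ) + -k).toNat) 𝒰
        (𝓝 (∑ k ∈ Finset.range N, c)) := tendsto_finsetSum _ fun k _ => (hc k (-k)).1
    rw [Finset.sum_const, Finset.card_range, nsmul_eq_mul] at h1
    refine le_of_tendsto h1 ?_
    filter_upwards [hy'.eventually_ge_atTop N] with n hn
    have h2 : ∑ k ∈ Finset.range N, absorb p φ φ ((x n : ℤ) + k).toNat ((y n : ℤ) + -k).toNat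
        = ∑ z ∈ (Finset.range N).image (fun k => x n + k), absorb p φ φ z (x n + y n - z) := by
      rw [Finset.sum_image fun a _ b _ h => by simpa using h]
      refine Finset.sum_congr rfl fun k hk => ?_
      rw [Finset.mem_range] at hk
      congr 1
      omega
    rw [h2]
    refine le_trans (Finset.sum_le_sum_of_subset_of_nonneg ?_ fun _ _ _ => h0 _ _)
      ((hp.sum_antidiagonal_absorb_le hφ (x n + y n)).trans (hK _))
    intro z hz
    simp only [Finset.mem_image, Finset.mem_range] at hz ⊢
    omega
  have : c = 0 := by
    by_contra hne
    have hpos : 0 < c := lt_of_le_of_ne hc0 (Ne.symm hne)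
    obtain ⟨N, hN'⟩ := exists_nat_gt (K / c)
    rw [div_lt_iff₀ hpos] at hN'
    linarith [hN N]
  rwa [this] at hmain

lemma BlockLaw.tendsto_absorb_zero (hp : BlockLaw p m) {ι : Type*} {f : Filter ι}
    {x y : ι → ℕ} (hx : Tendsto x f atTop) (hy : Tendsto y f atTop) {φ : ℕ → ℝ}
    (hφ : Tendsto φ atTop (𝓝 0)) :
    Tendsto (fun n => absorb p φ φ (x n) (y n)) f (𝓝 0) := by
  rw [Metric.tendsto_nhds]
  intro ε hε
  obtain ⟨J, hJ⟩ := (eventually_atTop.1 ((Metric.tendsto_nhds.1 hφ) (ε / 2) (by linarith)))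
  -- `|φ|` is bounded by the constant `ε / 2` plus a finitely supported part `η`, which has bounded
  -- sums.
  set η : ℕ → ℝ := fun k => if k < J then |φ k| else 0 with hη
  have hη0 : ∀ k, 0 ≤ η k := fun k => by simp only [hη]; split_ifs <;> positivity
  have hK : ∀ n, ∑ k ∈ Finset.range n, η k ≤ ∑ k ∈ Finset.range J, |φ k| := by
    intro n
    simp only [hη]
    rw [← Finset.sum_filter]
    refine Finset.sum_le_sum_of_subset_of_nonneg ?_ fun _ _ _ => abs_nonneg _
    intro k hk
    simp only [Finset.mem_filter] at hk
    exact Finset.mem_range.2 hk.2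
  have h1 := hp.tendsto_absorb_zero_of_bounded_sum hx hy hη0 hK
  filter_upwards [(Metric.tendsto_nhds.1 h1) (ε / 2) (by linarith)] with n hn
  rw [Real.dist_eq, sub_zero] at hn ⊢
  have hφle : ∀ k, |φ k| ≤ (fun k => (fun _ => ε / 2) k + η k) k := by
    intro k
    simp only [hη]
    split_ifs with h
    · linarith [abs_nonneg (φ k)]
    · have := hJ k (not_lt.1 h)
      rw [Real.dist_eq, sub_zero] at this
      linarith
  have h2 := hp.abs_absorb_le_absorb hφle hφle (x n) (y n)
  rw [absorb_add] at h2
  have h3 := hp.abs_absorb_le (M := ε / 2) (φ := fun _ => ε / 2) (ψ := fun _ => ε / 2)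
    (fun _ => by rw [abs_of_pos (by linarith)]) (fun _ => by rw [abs_of_pos (by linarith)])
    (x n) (y n)
  have := abs_le.1 h3
  have := abs_le.1 hn.le
  have := le_abs_self (absorb p η η (x n) (y n))
  linarith

/-- The probability that a jump made from distance `x` does not reach the axis. -/
def stay (p : ℕ → ℝ) (x : ℕ) : ℝ := 1 - tail p (x - 1)

lemma stay_eq (p : ℕ → ℝ) (x : ℕ) : stay p x = ∑ i ∈ Finset.range (x - 1), p (i + 1) := by
  simp [stay, tail]

/-- The walk leaves the quadrant from one of its points, either horizontally or vertically. -/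
lemma sum_tail_absorb_eq_one (p : ℕ → ℝ) (x y : ℕ) :
    tail p x + ∑ j ∈ Finset.range (y + 1), tail p j * absorb p (stay p) 0 (x + 1) (y - j)
      + ∑ j ∈ Finset.range (x + 1), tail p j * absorb p 0 (stay p) (x - j) (y + 1) = 1 := by
  -- Induction by conditioning on the first jump. In the first sum the walk reaches height `j` with
  -- a horizontal jump pending, survives it with probability `stay`, then overshoots vertically with
  -- probability `tail p j`; the second sum exchanges the roles. The offset in `x + 1` and `y + 1`
  -- makes coordinate `0` interior, the axis being the first position outside.
  induction h : x + y using Nat.strong_induction_on generalizing x y with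
  | _ n ih =>
    have hQ : ∀ k, stay p (k + 1) = ∑ i ∈ Finset.range k, p (i + 1) := fun k => stay_eq p (k + 1)
    have e0 : ∑ j ∈ Finset.range (y + 1), tail p j * absorb p (stay p) 0 (x + 1) (y - j)
        = tail p y * ∑ i ∈ Finset.range x, p (i + 1)
          + ∑ i ∈ Finset.range x, p (i + 1) *
            ∑ j ∈ Finset.range y, tail p j * absorb p 0 (stay p) (y - j) (x - 1 - i + 1) := by
      rw [Finset.sum_range_succ, Nat.sub_self, absorb_zero, hQ, add_comm]
      congr 1
      simp only [Finset.mul_sum]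
      rw [Finset.sum_comm]
      refine Finset.sum_congr rfl fun j hj => ?_
      rw [Finset.mem_range] at hj
      rw [absorb_of_pos _ _ _ (by omega : 1 ≤ y - j), Finset.sum_range_succ,
        show x + 1 - 1 - x = 0 by omega, absorb_zero]
      simp only [Pi.zero_apply, mul_zero, add_zero]
      rw [Finset.mul_sum]
      refine Finset.sum_congr rfl fun i hi => ?_
      rw [Finset.mem_range] at hi
      rw [show x + 1 - 1 - i = x - 1 - i + 1 by omega]
      ring
    have f0 : ∑ j ∈ Finset.range (x + 1), tail p j * absorb p 0 (stay p) (x - j) (y + 1)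
        = ∑ i ∈ Finset.range x, p (i + 1) *
            ∑ j ∈ Finset.range (x - 1 - i + 1),
              tail p j * absorb p (stay p) 0 (y + 1) (x - 1 - i - j) := by
      rw [Finset.sum_range_succ, Nat.sub_self, absorb_zero_left _ _ (by omega), mul_zero, add_zero]
      simp only [Finset.mul_sum]
      rw [Finset.sum_sigma']
      have : ∑ j ∈ Finset.range x, tail p j * absorb p 0 (stay p) (x - j) (y + 1)
          = ∑ j ∈ Finset.range x, ∑ i ∈ Finset.range (x - j),
            tail p j * (p (i + 1) * absorb p (stay p) 0 (y + 1) (x - j - 1 - i)) := by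
        refine Finset.sum_congr rfl fun j _ => ?_
        rw [absorb_of_pos _ _ _ (by omega : 1 ≤ y + 1), Finset.mul_sum]
      rw [this, Finset.sum_sigma']
      refine Finset.sum_bij' (fun a _ => ⟨a.2, a.1⟩) (fun a _ => ⟨a.2, a.1⟩) ?_ ?_ ?_ ?_ ?_
      · rintro ⟨a, b⟩ h
        simp only [Finset.mem_sigma, Finset.mem_range] at h ⊢
        omega
      · rintro ⟨a, b⟩ h
        simp only [Finset.mem_sigma, Finset.mem_range] at h ⊢
        omega
      · intros; rfl
      · intros; rfl
      · rintro ⟨a, b⟩ h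
        simp only [Finset.mem_sigma, Finset.mem_range] at h
        have : x - a - 1 - b = x - 1 - b - a := by omega
        simp only [this]
        ring
    have hsum : ∀ i ∈ Finset.range x,
        p (i + 1) * (∑ j ∈ Finset.range y, tail p j * absorb p 0 (stay p) (y - j) (x - 1 - i + 1))
        + p (i + 1) * (∑ j ∈ Finset.range (x - 1 - i + 1),
              tail p j * absorb p (stay p) 0 (y + 1) (x - 1 - i - j))
        = p (i + 1) - p (i + 1) * tail p y := by
      intro i hi
      rw [Finset.mem_range] at hi
      have h1 := ih (y + (x - 1 - i)) (by omega) y (x - 1 - i) rfl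
      rw [Finset.sum_range_succ _ y, Nat.sub_self, absorb_zero_left _ _ (by omega), mul_zero,
        add_zero] at h1
      linear_combination p (i + 1) * h1
    rw [e0, f0]
    have h2 := Finset.sum_congr rfl hsum
    rw [Finset.sum_add_distrib, Finset.sum_sub_distrib, ← Finset.sum_mul] at h2
    have h3 : tail p x = 1 - ∑ i ∈ Finset.range x, p (i + 1) := rfl
    linear_combination h2 + h3

lemma BlockLaw.abs_stay_le (hp : BlockLaw p m) (x : ℕ) : |stay p x| ≤ 1 := by
  have h1 := hp.tail_nonneg (x - 1)
  have h2 := hp.tail_le_one (x - 1)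
  rw [stay, abs_of_nonneg (by linarith)]
  linarith

lemma BlockLaw.tendsto_stay (hp : BlockLaw p m) : Tendsto (stay p) atTop (𝓝 1) := by
  have h1 : Tendsto (fun x : ℕ => x - 1) atTop atTop := tendsto_sub_atTop_nat 1
  have h2 := (hp.tendsto_tail.comp h1).const_sub 1
  rw [sub_zero] at h2
  exact h2

lemma BlockLaw.tendsto_absorb_stay (hp : BlockLaw p m) {ι : Type*} {f : Filter ι}
    {x y : ι → ℕ} (hx : Tendsto x f atTop) (hy : Tendsto y f atTop) :
    Tendsto (fun n => absorb p (stay p) (stay p) (x n) (y n)) f (𝓝 (1 / m)) := by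
  rw [tendsto_iff_ultrafilter]
  intro 𝒰 h𝒰
  have hx' := hx.mono_left h𝒰
  have hy' := hy.mono_left h𝒰
  have hz : ∀ k : ℕ, |(0 : ℕ → ℝ) k| ≤ 1 := fun k => by simp
  obtain ⟨c, hc⟩ := hp.exists_absorb_shift_limit 𝒰 hx' hy' hp.abs_stay_le hz
  obtain ⟨c', hc'⟩ := hp.exists_absorb_shift_limit 𝒰 hx' hy' hz hp.abs_stay_le
  have hsplit : ∀ n, absorb p (stay p) (stay p) (x n) (y n)
      = absorb p (stay p) 0 (x n) (y n) + absorb p 0 (stay p) (x n) (y n) := by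
    intro n
    rw [← absorb_add]
    simp
  have hmain : Tendsto (fun n => absorb p (stay p) (stay p) (x n) (y n)) 𝒰 (𝓝 (c + c')) := by
    simp only [hsplit]
    simpa using (hc 0 0).1.add (hc' 0 0).1
  have hadd : ∀ {z : ι → ℕ}, Tendsto z 𝒰 atTop → Tendsto (fun n => z n + 1) 𝒰 atTop :=
    fun hz => tendsto_atTop_mono (fun n => Nat.le_succ _) hz
  have h1 : Tendsto (fun n => ∑ j ∈ Finset.range (y n + 1),
      tail p j * absorb p (stay p) 0 (x n + 1) (y n - j)) 𝒰 (𝓝 (∑' j, tail p j * c)) :=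
    tendsto_sum_range_mul hp.hasSum_tail.summable hp.tail_nonneg (hadd hy')
      (F := fun n j => absorb p (stay p) 0 (x n + 1) (y n - j)) (M := 1)
      (fun n i => hp.abs_absorb_le hp.abs_stay_le hz _ _) fun i => by
        refine (hc 1 (-i)).1.congr' (Eventually.of_forall fun n => ?_)
        congr 1
        omega
  have h2 : Tendsto (fun n => ∑ j ∈ Finset.range (x n + 1),
      tail p j * absorb p 0 (stay p) (x n - j) (y n + 1)) 𝒰 (𝓝 (∑' j, tail p j * c')) :=
    tendsto_sum_range_mul hp.hasSum_tail.summable hp.tail_nonneg (hadd hx')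
      (F := fun n j => absorb p 0 (stay p) (x n - j) (y n + 1)) (M := 1)
      (fun n i => hp.abs_absorb_le hz hp.abs_stay_le _ _) fun i => by
        refine (hc' (-i) 1).1.congr' (Eventually.of_forall fun n => ?_)
        congr 1
        omega
  rw [tsum_mul_right, hp.hasSum_tail.tsum_eq] at h1 h2
  have h3 := ((hp.tendsto_tail.comp hx').add h1).add h2
  -- The balance of exits in the limit: the tails sum to `m`, and an exit at the very first jump
  -- becomes impossible.
  have h4 : 0 + m * c + m * c' = 1 := by
    refine tendsto_nhds_unique h3 (tendsto_const_nhds.congr fun n => ?_)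
    exact (sum_tail_absorb_eq_one p (x n) (y n)).symm
  have h5 : c + c' = 1 / m := by
    rw [eq_div_iff hp.mean_pos.ne']
    linarith
  rwa [h5] at hmain

/-- Far from both axes, the expected payoff is the limiting payoff times the renewal density. -/
theorem BlockLaw.tendsto_absorb (hp : BlockLaw p m) {ι : Type*} {f : Filter ι}
    {x y : ι → ℕ} (hx : Tendsto x f atTop) (hy : Tendsto y f atTop) {φ : ℕ → ℝ} {κ : ℝ}
    (hφ : Tendsto φ atTop (𝓝 κ)) :
    Tendsto (fun n => absorb p φ φ (x n) (y n)) f (𝓝 (κ / m)) := by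
  -- Since `stay` tends to `1`, subtracting `κ * stay` leaves a payoff that vanishes at infinity.
  have h1 : Tendsto (fun k => φ k + -κ * stay p k) atTop (𝓝 0) := by
    have := hφ.add (hp.tendsto_stay.const_mul (-κ))
    simpa using this
  have h2 := (hp.tendsto_absorb_zero hx hy h1).add ((hp.tendsto_absorb_stay hx hy).const_mul κ)
  rw [zero_add, mul_one_div] at h2
  refine h2.congr fun n => ?_
  rw [absorb_add, absorb_const_mul]
  ring

/-- Close to the horizontal axis, the expected payoff is the limiting payoff times the renewal
probability `u y`. -/
theorem BlockLaw.tendsto_absorb_fixed (hp : BlockLaw p m) {φ : ℕ → ℝ} {κ M : ℝ}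
    (hφ : Tendsto φ atTop (𝓝 κ)) (hM : ∀ k, |φ k| ≤ M) {u : ℕ → ℝ} (hu0 : u 0 = 1)
    (hu : ∀ n, u (n + 1) = ∑ i ∈ Finset.range (n + 1), p (i + 1) * u (n - i)) (y : ℕ) :
    Tendsto (fun x => absorb p φ φ x y) atTop (𝓝 (κ * u y)) ∧
    Tendsto (fun x => absorb p φ φ y x) atTop (𝓝 (if y = 0 then 0 else κ * u y)) := by
  induction y using Nat.strong_induction_on with
  | _ y ih =>
    rcases y with _ | y
    · rw [hu0, mul_one, if_pos rfl]
      refine ⟨by simpa only [absorb_zero] using hφ, ?_⟩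
      refine tendsto_const_nhds.congr' ?_
      filter_upwards [eventually_ge_atTop 1] with x hx
      rw [absorb_zero_left _ _ hx]
    · rw [if_neg (Nat.succ_ne_zero y)]
      -- A jump in the short coordinate reproduces the renewal recursion; a jump in the long
      -- coordinate, treated afterwards, leaves the limit unchanged.
      have h2 : Tendsto (fun x => absorb p φ φ (y + 1) x) atTop (𝓝 (κ * u (y + 1))) := by
        have h3 : Tendsto (fun x => ∑ i ∈ Finset.range (y + 1),
            p (i + 1) * absorb p φ φ x (y - i)) atTop
            (𝓝 (∑ i ∈ Finset.range (y + 1), p (i + 1) * (κ * u (y - i)))) :=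
          tendsto_finsetSum _ fun i hi => ((ih (y - i) (by omega)).1).const_mul _
        have h4 : ∑ i ∈ Finset.range (y + 1), p (i + 1) * (κ * u (y - i)) = κ * u (y + 1) := by
          rw [hu, Finset.mul_sum]
          exact Finset.sum_congr rfl fun i _ => by ring
        rw [h4] at h3
        refine h3.congr' ?_
        filter_upwards [eventually_ge_atTop 1] with x hx
        rw [absorb_of_pos _ _ _ hx]
        rfl
      refine ⟨?_, h2⟩
      have h5 := tendsto_sum_range_mul hp.hasSum.summable (fun i => (hp.pos i).le)
        (tendsto_id (α := ℕ) (x := atTop)) (F := fun x i => absorb p φ φ (y + 1) (x - 1 - i))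
        (c := fun _ => κ * u (y + 1)) (M := M) (fun x i => hp.abs_absorb_le hM hM _ _)
        (fun i => h2.comp ((tendsto_sub_atTop_nat i).comp (tendsto_sub_atTop_nat 1)))
      rw [tsum_mul_right, hp.hasSum.tsum_eq, one_mul] at h5
      refine h5.congr fun x => ?_
      rw [absorb_of_pos _ _ _ (by omega)]
      rfl

end absorb

/-- The renewal theorem for sequences of blocks whose last block is not a singleton. -/
theorem BlockLaw.tendsto_renewal {p : ℕ → ℝ} {m : ℝ} (hp : BlockLaw p m) {V : ℕ → ℝ}
    (h0 : V 0 = 1) (h1 : V 1 = 0)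
    (hV : ∀ n, 2 ≤ n → V n = ∑ i ∈ Finset.range n, p (i + 1) * V (n - 1 - i)) :
    (∀ n, |V n| ≤ 1) ∧ Tendsto V atTop (𝓝 ((1 - p 1) / m)) := by
  have hle : ∀ n, |V n| ≤ 1 := by
    intro n
    induction n using Nat.strong_induction_on with
    | _ n ih =>
      rcases n with _ | _ | n
      · simp [h0]
      · simp [h1]
      · rw [hV _ (by omega)]
        exact hp.abs_sum_le zero_le_one fun i hi => ih _ (by omega)
  refine ⟨hle, ?_⟩
  -- A conserved quantity of the recursion; at `n = 0` only `tail p 1 * V 0` survives because `V 1 =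
  -- 0`.
  have hid : ∀ n, ∑ k ∈ Finset.range (n + 2), tail p k * V (n + 1 - k) = 1 - p 1 := by
    intro n
    induction n with
    | zero => simp [Finset.sum_range_succ, h0, h1, tail]
    | succ n ih =>
      have h2 := hV (n + 2) (by omega)
      rw [Finset.sum_range_succ', tail_zero, ← ih]
      simp only [tail_succ, sub_mul, Finset.sum_sub_distrib, one_mul]
      have h3 : ∀ k ∈ Finset.range (n + 2), tail p k * V (n + 1 + 1 - (k + 1))
          = tail p k * V (n + 1 - k) := fun k _ => by
        rw [show n + 1 + 1 - (k + 1) = n + 1 - k by omega]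
      have h4 : ∀ k ∈ Finset.range (n + 2), p (k + 1) * V (n + 1 + 1 - (k + 1))
          = p (k + 1) * V (n + 2 - 1 - k) := fun k _ => by
        rw [show n + 1 + 1 - (k + 1) = n + 2 - 1 - k by omega]
      rw [show n + 1 + 1 = n + 2 by rfl] at *
      rw [Finset.sum_congr rfl h3, Finset.sum_congr rfl h4, ← h2, Nat.sub_zero]
      ring
  rw [tendsto_iff_ultrafilter]
  intro 𝒰 h𝒰
  have hx : Tendsto (fun n : ℕ => n) 𝒰 atTop := h𝒰
  -- `V` is read as an array constant in `y`, so averaging over `y` loses only `tail p y`. The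
  -- recursion fails at index `1`, where the error bound is taken to be `1`.
  obtain ⟨c, hc⟩ := exists_shift_limit hp 𝒰 hx hx (A := fun x _ => V x) (B := fun x _ => V x)
    (M := 1) (ε := fun n => if n ≤ 1 then 1 else tail p n) (fun x _ => hle x) (fun x _ => hle x)
    (by
      refine hp.tendsto_tail.congr' ?_
      filter_upwards [eventually_gt_atTop 1] with n hn
      rw [if_neg (by omega)])
    (by
      intro x _ hx1 _
      rcases Nat.lt_or_ge 1 x with h | h
      · rw [if_neg (by omega), hV x h, sub_self, abs_zero]
        exact hp.tail_nonneg x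
      · obtain rfl : x = 1 := le_antisymm h hx1
        simpa [h0, h1] using hp.abs_sum_le (x := 1) (b := fun _ => 1) zero_le_one (by simp))
    (by
      intro x y _ hy1
      rw [← Finset.sum_mul, ← one_sub_mul, abs_mul]
      have h3 : tail p y = 1 - ∑ i ∈ Finset.range y, p (i + 1) := rfl
      rw [← h3, abs_of_nonneg (hp.tail_nonneg y)]
      refine (mul_le_of_le_one_right (hp.tail_nonneg y) (hle x)).trans ?_
      split_ifs with h
      · exact hp.tail_le_one y
      · exact le_rfl)
  have hmain : Tendsto V 𝒰 (𝓝 c) := by simpa using (hc 0 0).1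
  have h2 : Tendsto (fun n => ∑ k ∈ Finset.range (n + 2), tail p k * V (n + 1 - k)) 𝒰
      (𝓝 (∑' j, tail p j * c)) :=
    tendsto_sum_range_mul hp.hasSum_tail.summable hp.tail_nonneg
      (tendsto_atTop_mono (fun n => by omega) hx)
      (F := fun n j => V (n + 1 - j)) (M := 1) (fun n i => hle _) fun i => by
        refine (hc (1 - i) 0).1.congr' (Eventually.of_forall fun n => ?_)
        congr 1
        omega
  rw [tsum_mul_right, hp.hasSum_tail.tsum_eq] at h2
  simp only [hid] at h2
  have h3 : (1 - p 1) / m = c := by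
    rw [div_eq_iff hp.mean_pos.ne', tendsto_nhds_unique tendsto_const_nhds h2]
    ring
  rwa [h3]

/-! ### Asymptotics of normalised counts that are built by peeling blocks -/

/-- The relations between the normalised numbers `E n d` (resp. `F n d`) of threshold graphs of
order `n` with (resp. without) isolated vertices and exactly `l` vertices of degree `d`, and the
normalised numbers `V n` of threshold graphs of order `n` without isolated vertices. -/
structure Peeling (p : ℕ → ℝ) (V : ℕ → ℝ) (l : ℕ) (E F : ℕ → ℕ → ℝ) : Prop where
  zero : V 0 = 1
  one : V 1 = 0
  renewal : ∀ n, 2 ≤ n → V n = ∑ i ∈ Finset.range n, p (i + 1) * V (n - 1 - i)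
  compl : ∀ n d, 2 ≤ n → d < n → F n d = E n (n - 1 - d)
  vanish : ∀ n d, n ≤ d → F n d = 0
  peel : ∀ n d, 1 ≤ d → E n d = ∑ i ∈ Finset.range n, p (i + 1) * F (n - 1 - i) d
  isolated : ∀ n, 2 ≤ n → E n 0 = if l ≤ n then p l * V (n - l) else 0

namespace Peeling

variable {p V : ℕ → ℝ} {m : ℝ} {l : ℕ} {E F : ℕ → ℕ → ℝ}

/-- The payoff at the axes of the walk that describes the peeling. -/
def payoff (p V : ℕ → ℝ) (l : ℕ) (x : ℕ) : ℝ :=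
  if l ≤ x + 1 then p l * V (x + 1 - l) else 0

/-- With codegree `x` and degree `y`, peeling is a jump in `x` and complementation swaps the
coordinates. -/
lemma eq_absorb (h : Peeling p V l E F) (x y : ℕ) (hxy : 1 ≤ x + y) :
    E (x + y + 1) y = absorb p (payoff p V l) (payoff p V l) x y := by
  refine ThresholdGraph.eq_absorb (a := fun x y => E (x + y + 1) y) ?_ ?_ x y hxy
  · intro x hx
    exact h.isolated (x + 0 + 1) (by omega)
  · intro x y hy
    rw [h.peel _ _ hy, add_assoc, Finset.sum_range_add]
    -- Removing more than `x` vertices leaves order at most `y`, where degree `y` cannot occur.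
    have h0 : ∀ i ∈ Finset.range (y + 1), p (x + i + 1) * F (x + (y + 1) - 1 - (x + i)) y = 0 :=
      fun i _ => by rw [h.vanish _ _ (by omega), mul_zero]
    rw [Finset.sum_eq_zero h0, add_zero]
    refine Finset.sum_congr rfl fun i hi => ?_
    rw [Finset.mem_range] at hi
    rw [h.compl _ _ (by omega) (by omega)]
    congr 2 <;> omega

lemma add_eq (h : Peeling p V l E F) {n d : ℕ} (hn : 2 ≤ n) (hd : d < n) :
    E n d + F n d = absorb p (payoff p V l) (payoff p V l) (n - 1 - d) d
      + absorb p (payoff p V l) (payoff p V l) d (n - 1 - d) := by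
  rw [h.compl n d hn hd, ← h.eq_absorb _ _ (by omega), ← h.eq_absorb _ _ (by omega)]
  congr 2 <;> omega

lemma abs_payoff_le (hp : BlockLaw p m) (hl : 1 ≤ l) (h : Peeling p V l E F) (x : ℕ) :
    |payoff p V l x| ≤ p l := by
  have hpl : 0 < p l := by
    obtain ⟨k, rfl⟩ := Nat.exists_eq_add_of_le' hl
    exact hp.pos k
  rw [payoff]
  split_ifs
  · rw [abs_mul, abs_of_pos hpl]
    exact mul_le_of_le_one_right hpl.le ((hp.tendsto_renewal h.zero h.one h.renewal).1 _)
  · simpa using hpl.le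

lemma tendsto_payoff (hp : BlockLaw p m) (h : Peeling p V l E F) :
    Tendsto (payoff p V l) atTop (𝓝 (p l * ((1 - p 1) / m))) := by
  have h1 : Tendsto (fun x : ℕ => x + 1 - l) atTop atTop :=
    (tendsto_sub_atTop_nat l).comp (tendsto_add_atTop_nat 1)
  refine (((hp.tendsto_renewal h.zero h.one h.renewal).2.comp h1).const_mul (p l)).congr' ?_
  filter_upwards [eventually_ge_atTop l] with x hx
  rw [payoff, if_pos (by omega)]
  rfl

lemma add_le (hp : BlockLaw p m) (hl : 1 ≤ l) (h : Peeling p V l E F) {n d : ℕ} (hn : 2 ≤ n)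
    (hd : d < n) : E n d + F n d ≤ 2 * p l := by
  rw [h.add_eq hn hd]
  have h1 := hp.abs_absorb_le (h.abs_payoff_le hp hl) (h.abs_payoff_le hp hl) (n - 1 - d) d
  have h2 := hp.abs_absorb_le (h.abs_payoff_le hp hl) (h.abs_payoff_le hp hl) d (n - 1 - d)
  have := abs_le.1 h1
  have := abs_le.1 h2
  linarith

/-- Blocks of size `2` have positive weight, so `p 1 < 1`. -/
lemma limit_pos (hp : BlockLaw p m) : 0 < (1 - p 1) / m := by
  refine div_pos ?_ hp.mean_pos
  have h1 := hp.sum_le_one 2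
  have := hp.pos 1
  simp [Finset.sum_range_succ] at h1
  norm_num at this
  linarith

/-- The proportion of graphs with exactly `l` vertices of degree `d`, both `d` and `n - 1 - d`
tending to infinity. -/
theorem tendsto_of_atTop (hp : BlockLaw p m) (h : Peeling p V l E F)
    {f : Filter ℕ} (hf : f ≤ atTop) {d : ℕ → ℕ} (hd : Tendsto d f atTop)
    (hd' : Tendsto (fun n => n - 1 - d n) f atTop) :
    Tendsto (fun n => (E n (d n) + F n (d n)) / (2 * V n)) f (𝓝 (p l * (1 / m))) := by
  have hv := limit_pos hp
  have h1 := hp.tendsto_absorb hd' hd (h.tendsto_payoff hp)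
  have h2 := hp.tendsto_absorb hd hd' (h.tendsto_payoff hp)
  have hV := (hp.tendsto_renewal h.zero h.one h.renewal).2.mono_left hf
  have h3 := (h1.add h2).div (hV.const_mul 2) (mul_pos two_pos hv).ne'
  have h4 : (p l * ((1 - p 1) / m) / m + p l * ((1 - p 1) / m) / m) / (2 * ((1 - p 1) / m))
      = p l * (1 / m) := by
    generalize (1 - p 1) / m = v at hv
    field_simp
    ring
  rw [h4] at h3
  refine h3.congr' ?_
  filter_upwards [hf (eventually_ge_atTop 2), hd'.eventually_ge_atTop 1] with n hn hn'
  simp only [Pi.div_apply, h.add_eq hn (by omega : d n < n)]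

/-- The proportion of graphs with exactly `l` vertices of a fixed degree `d`. -/
theorem tendsto_fixed (hp : BlockLaw p m) (hl : 1 ≤ l) (h : Peeling p V l E F)
    {u : ℕ → ℝ} (hu0 : u 0 = 1)
    (hu : ∀ n, u (n + 1) = ∑ i ∈ Finset.range (n + 1), p (i + 1) * u (n - i)) (d : ℕ) :
    Tendsto (fun n => (E n d + F n d) / (2 * V n)) atTop
      (𝓝 (p l * if d = 0 then 1 / 2 else u d)) := by
  have hv := limit_pos hp
  have hn : Tendsto (fun n : ℕ => n - 1 - d) atTop atTop :=
    (tendsto_sub_atTop_nat d).comp (tendsto_sub_atTop_nat 1)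
  have h1 := hp.tendsto_absorb_fixed (h.tendsto_payoff hp) (h.abs_payoff_le hp hl) hu0 hu d
  have hV := (hp.tendsto_renewal h.zero h.one h.renewal).2
  have h3 := ((h1.1.comp hn).add (h1.2.comp hn)).div (hV.const_mul 2) (mul_pos two_pos hv).ne'
  -- For `d = 0` the graphs without isolated vertices contribute nothing, hence `1 / 2` in place of
  -- `u 0 = 1`.
  have h4 : (p l * ((1 - p 1) / m) * u d + if d = 0 then 0 else p l * ((1 - p 1) / m) * u d)
      / (2 * ((1 - p 1) / m)) = p l * if d = 0 then 1 / 2 else u d := by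
    generalize (1 - p 1) / m = v at hv
    split_ifs with hd
    · rw [hd, hu0]
      field_simp
      ring
    · field_simp
      ring
  rw [h4] at h3
  refine h3.congr' ?_
  filter_upwards [eventually_ge_atTop (d + 2)] with n hn
  simp only [Pi.div_apply, h.add_eq (by omega : 2 ≤ n) (by omega : d < n), Function.comp]

lemma add_symm (h : Peeling p V l E F) {n d : ℕ} (hn : 2 ≤ n) (hd : d < n) :
    E n (n - 1 - d) + F n (n - 1 - d) = E n d + F n d := by
  rw [h.compl n d hn hd, h.compl n _ hn (by omega), show n - 1 - (n - 1 - d) = d by omega, add_comm]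

/-- The proportion of graphs with exactly `l` vertices of a fixed codegree `d`. -/
theorem tendsto_fixed_compl (hp : BlockLaw p m) (hl : 1 ≤ l) (h : Peeling p V l E F)
    {u : ℕ → ℝ} (hu0 : u 0 = 1)
    (hu : ∀ n, u (n + 1) = ∑ i ∈ Finset.range (n + 1), p (i + 1) * u (n - i)) (d : ℕ) :
    Tendsto (fun n => (E n (n - 1 - d) + F n (n - 1 - d)) / (2 * V n)) atTop
      (𝓝 (p l * if d = 0 then 1 / 2 else u d)) := by
  refine (h.tendsto_fixed hp hl hu0 hu d).congr' ?_
  filter_upwards [eventually_ge_atTop (d + 2)] with n hn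
  rw [h.add_symm (by omega) (by omega)]

end Peeling

/-! ### Combinatorial classes of graphs that can be peeled -/

/-- A sequence of finite classes `X n` (of graphs of order `n`) with degree statistics `N x d` such
that an object with `i` isolated vertices is obtained in `w n i` ways from an object of `X (n - i)`
without isolated vertices, with a degree-reversing bijection, and such that every object has either
isolated or dominating vertices. -/
structure PeelableClass (X : ℕ → Type) [∀ n, Fintype (X n)] (N : (n : ℕ) → X n → ℕ → ℕ)
    (w : ℕ → ℕ → ℕ) : Prop where
  fiber : ∀ n i d l, i ≤ n → 1 ≤ d →
    Nat.card {x : X n // N n x 0 = i ∧ N n x d = l}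
      = w n i * Nat.card {x : X (n - i) // N (n - i) x 0 = 0 ∧ N (n - i) x d = l}
  compl : ∀ n, ∃ c : X n ≃ X n, ∀ x d, d < n → N n (c x) d = N n x (n - 1 - d)
  dichotomy : ∀ n x, 2 ≤ n → (N n x 0 = 0 ↔ N n x (n - 1) ≠ 0)
  le : ∀ n x d, N n x d ≤ n
  vanish : ∀ n x d, n ≤ d → N n x d = 0
  card_zero : Nat.card (X 0) = 1
  one : ∀ x, N 1 x 0 ≠ 0

namespace PeelableClass

variable {X : ℕ → Type} [∀ n, Fintype (X n)] {N : (n : ℕ) → X n → ℕ → ℕ} {w : ℕ → ℕ → ℕ}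

variable (X N) in
/-- The number of objects with isolated vertices and exactly `l` vertices of degree `d`. -/
def isolCard (l n d : ℕ) : ℕ := Nat.card {x : X n // N n x 0 ≠ 0 ∧ N n x d = l}

variable (X N) in
/-- The number of objects without isolated vertices and with exactly `l` vertices of degree `d`. -/
def noIsolCard (l n d : ℕ) : ℕ := Nat.card {x : X n // N n x 0 = 0 ∧ N n x d = l}

variable (X N) in
/-- The number of objects without isolated vertices. -/
def noIsolTotal (n : ℕ) : ℕ := Nat.card {x : X n // N n x 0 = 0}

lemma card_add_card (n d l : ℕ) :
    isolCard X N l n d + noIsolCard X N l n d = Nat.card {x : X n // N n x d = l} := by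
  classical
  simp only [isolCard, noIsolCard, Nat.card_eq_fintype_card, Fintype.card_subtype]
  rw [← Finset.card_filter_add_card_filter_not (s := Finset.univ.filter fun x => N n x d = l)
    (fun x => N n x 0 ≠ 0), Finset.filter_filter, Finset.filter_filter]
  simp only [not_not, and_comm]

/-- A degree `d ≥ n` never occurs, so asking for zero such vertices is vacuous. This lets `fiber`
also count without a degree condition. -/
lemma noIsolTotal_eq (h : PeelableClass X N w) {n d : ℕ} (hd : n ≤ d) :
    noIsolTotal X N n = noIsolCard X N 0 n d := by
  simp only [noIsolTotal, noIsolCard, h.vanish _ _ _ hd, and_true]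

lemma isolCard_eq_sum (h : PeelableClass X N w) (l n : ℕ) {d : ℕ} (hd : 1 ≤ d) :
    isolCard X N l n d
      = ∑ i ∈ Finset.range n, w n (i + 1) * noIsolCard X N l (n - 1 - i) d := by
  classical
  have h1 : ∀ i ∈ Finset.range n, w n (i + 1) * noIsolCard X N l (n - 1 - i) d
      = (Finset.univ.filter fun x : X n => N n x 0 = i + 1 ∧ N n x d = l).card := by
    intro i hi
    rw [Finset.mem_range] at hi
    rw [← Fintype.card_subtype, ← Nat.card_eq_fintype_card, h.fiber n (i + 1) d l (by omega) hd,
      show n - (i + 1) = n - 1 - i by omega]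
    rfl
  rw [Finset.sum_congr rfl h1, isolCard, Nat.card_eq_fintype_card, Fintype.card_subtype,
    Finset.card_eq_sum_card_fiberwise (f := fun x => N n x 0 - 1) (t := Finset.range n)]
  · refine Finset.sum_congr rfl fun i hi => ?_
    rw [Finset.filter_filter]
    congr 1
    ext x
    simp only [Finset.mem_filter, Finset.mem_univ, true_and]
    omega
  · intro x hx
    simp only [Finset.coe_filter, Finset.mem_univ, true_and, Set.mem_ofPred_eq] at hx
    have := h.le n x 0
    simp only [Finset.coe_range, Set.mem_Iio]
    omega

lemma noIsolCard_compl (h : PeelableClass X N w) (l : ℕ) {n d : ℕ} (hn : 2 ≤ n) (hd : d < n) :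
    noIsolCard X N l n d = isolCard X N l n (n - 1 - d) := by
  obtain ⟨c, hc⟩ := h.compl n
  refine Nat.card_congr (c.subtypeEquiv fun x => ?_)
  rw [hc x 0 (by omega), hc x (n - 1 - d) (by omega), Nat.sub_zero,
    show n - 1 - (n - 1 - d) = d by omega, h.dichotomy n x hn]

lemma card_symm (h : PeelableClass X N w) {n d l : ℕ} (hd : d < n) :
    Nat.card {x : X n // N n x d = l} = Nat.card {x : X n // N n x (n - 1 - d) = l} := by
  obtain ⟨c, hc⟩ := h.compl n
  refine Nat.card_congr (c.subtypeEquiv fun x => ?_)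
  rw [hc x (n - 1 - d) (by omega), show n - 1 - (n - 1 - d) = d by omega]

lemma isolCard_zero (h : PeelableClass X N w) {l n : ℕ} (hl : 1 ≤ l) :
    isolCard X N l n 0 = if l ≤ n then w n l * noIsolTotal X N (n - l) else 0 := by
  have h1 : isolCard X N l n 0 = Nat.card {x : X n // N n x 0 = l} := by
    refine Nat.card_congr (Equiv.subtypeEquivRight fun x => ?_)
    omega
  rw [h1]
  split_ifs with hln
  · have h2 := h.fiber n l (n + 1) 0 hln (by omega)
    simp only [h.vanish n _ (n + 1) (by omega), and_true] at h2
    rw [h2, h.noIsolTotal_eq (show n - l ≤ n + 1 by omega)]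
    rfl
  · rw [Nat.card_eq_zero]
    left
    refine ⟨fun x => hln ?_⟩
    rw [← x.2]
    exact h.le _ _ _

lemma noIsolTotal_eq_sum (h : PeelableClass X N w) {n : ℕ} (hn : 2 ≤ n) :
    noIsolTotal X N n = ∑ i ∈ Finset.range n, w n (i + 1) * noIsolTotal X N (n - 1 - i) := by
  have h1 : noIsolTotal X N n = Nat.card {x : X n // N n x 0 ≠ 0} := by
    obtain ⟨c, hc⟩ := h.compl n
    refine Nat.card_congr (c.subtypeEquiv fun x => ?_)
    rw [hc x 0 (by omega), Nat.sub_zero, h.dichotomy n x hn]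
  have h2 : Nat.card {x : X n // N n x 0 ≠ 0} = isolCard X N 0 n (n + 1) := by
    simp only [isolCard, h.vanish n _ (n + 1) (by omega), and_true]
  rw [h1, h2, h.isolCard_eq_sum 0 n (by omega)]
  refine Finset.sum_congr rfl fun i _ => ?_
  rw [h.noIsolTotal_eq (show n - 1 - i ≤ n + 1 by omega)]

lemma card_eq_two_mul (h : PeelableClass X N w) {n : ℕ} (hn : 2 ≤ n) :
    Nat.card (X n) = 2 * noIsolTotal X N n := by
  have h1 : noIsolTotal X N n = Nat.card {x : X n // N n x 0 ≠ 0} := by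
    obtain ⟨c, hc⟩ := h.compl n
    refine Nat.card_congr (c.subtypeEquiv fun x => ?_)
    rw [hc x 0 (by omega), Nat.sub_zero, h.dichotomy n x hn]
  have h2 : Nat.card {x : X n // N n x 0 ≠ 0} + noIsolTotal X N n = Nat.card (X n) := by
    classical
    simp only [noIsolTotal, Nat.card_eq_fintype_card, Fintype.card_subtype]
    rw [← Finset.card_univ, add_comm]
    exact Finset.card_filter_add_card_filter_not _
  omega

/-- The normalised counts of a peelable class satisfy the peeling relations. -/
lemma peeling (h : PeelableClass X N w) {p c : ℕ → ℝ} (hc0 : c 0 = 1)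
    (hc : ∀ n i, 1 ≤ i → i ≤ n → c n * w n i = p i * c (n - i)) {l : ℕ} (hl : 1 ≤ l) :
    Peeling p (fun n => c n * noIsolTotal X N n) l (fun n d => c n * isolCard X N l n d)
      (fun n d => c n * noIsolCard X N l n d) where
  zero := by
    have : noIsolTotal X N 0 = 1 := by
      simp only [noIsolTotal, h.vanish 0 _ 0 le_rfl]
      rw [← h.card_zero]
      exact Nat.card_congr (Equiv.subtypeUnivEquiv fun _ => trivial)
    simp [hc0, this]
  one := by
    have : noIsolTotal X N 1 = 0 := by
      rw [noIsolTotal, Nat.card_eq_zero]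
      exact Or.inl ⟨fun x => h.one x.1 x.2⟩
    simp [this]
  renewal n hn := by
    rw [h.noIsolTotal_eq_sum hn]
    push_cast
    rw [Finset.mul_sum]
    refine Finset.sum_congr rfl fun i hi => ?_
    rw [Finset.mem_range] at hi
    rw [← mul_assoc, hc n (i + 1) (by omega) (by omega), show n - (i + 1) = n - 1 - i by omega,
      mul_assoc]
  compl n d hn hd := by rw [h.noIsolCard_compl l hn hd]
  vanish n d hd := by
    have : noIsolCard X N l n d = 0 := by
      rw [noIsolCard, Nat.card_eq_zero]
      refine Or.inl ⟨fun x => ?_⟩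
      have h1 := x.2.2
      rw [h.vanish _ _ _ hd] at h1
      omega
    simp [this]
  peel n d hd := by
    rw [h.isolCard_eq_sum l n hd]
    push_cast
    rw [Finset.mul_sum]
    refine Finset.sum_congr rfl fun i hi => ?_
    rw [Finset.mem_range] at hi
    rw [← mul_assoc, hc n (i + 1) (by omega) (by omega), show n - (i + 1) = n - 1 - i by omega,
      mul_assoc]
  isolated n _ := by
    rw [h.isolCard_zero hl]
    split_ifs with hln
    · push_cast
      rw [← mul_assoc, hc n l hl hln, mul_assoc]
    · simp

lemma ratio_eq (h : PeelableClass X N w) {c : ℕ → ℝ} (hc : ∀ n, 0 < c n) {l n d : ℕ}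
    (hn : 2 ≤ n) :
    (Nat.card {x : X n // N n x d = l} : ℝ) / Nat.card (X n)
      = (c n * isolCard X N l n d + c n * noIsolCard X N l n d)
        / (2 * (c n * noIsolTotal X N n)) := by
  rw [← card_add_card, h.card_eq_two_mul hn, ← mul_add, mul_left_comm, mul_div_mul_left _ _ (hc n).ne']
  push_cast
  rfl

section asymptotics

variable {p c : ℕ → ℝ} {m : ℝ}

/-- Both the degree and the codegree tend to infinity. -/
theorem tendsto_of_atTop (h : PeelableClass X N w) (hp : BlockLaw p m) (hc0 : c 0 = 1)
    (hcpos : ∀ n, 0 < c n) (hc : ∀ n i, 1 ≤ i → i ≤ n → c n * w n i = p i * c (n - i)) {l : ℕ}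
    (hl : 1 ≤ l) {f : Filter ℕ} (hf : f ≤ atTop) {d : ℕ → ℕ} (hd : Tendsto d f atTop)
    (hd' : Tendsto (fun n => n - 1 - d n) f atTop) :
    Tendsto (fun n => (Nat.card {x : X n // N n x (d n) = l} : ℝ) / Nat.card (X n)) f
      (𝓝 (p l * (1 / m))) := by
  refine ((h.peeling hc0 hc hl).tendsto_of_atTop hp hf hd hd').congr' ?_
  filter_upwards [hf (eventually_ge_atTop 2)] with n hn
  rw [h.ratio_eq hcpos hn]

theorem tendsto_fixed (h : PeelableClass X N w) (hp : BlockLaw p m) (hc0 : c 0 = 1)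
    (hcpos : ∀ n, 0 < c n) (hc : ∀ n i, 1 ≤ i → i ≤ n → c n * w n i = p i * c (n - i)) {l : ℕ}
    (hl : 1 ≤ l) {u : ℕ → ℝ} (hu0 : u 0 = 1)
    (hu : ∀ n, u (n + 1) = ∑ i ∈ Finset.range (n + 1), p (i + 1) * u (n - i)) (d : ℕ) :
    Tendsto (fun n => (Nat.card {x : X n // N n x d = l} : ℝ) / Nat.card (X n)) atTop
      (𝓝 (p l * if d = 0 then 1 / 2 else u d)) := by
  refine ((h.peeling hc0 hc hl).tendsto_fixed hp hl hu0 hu d).congr' ?_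
  filter_upwards [eventually_ge_atTop 2] with n hn
  rw [h.ratio_eq hcpos hn]

theorem tendsto_fixed_compl (h : PeelableClass X N w) (hp : BlockLaw p m) (hc0 : c 0 = 1)
    (hcpos : ∀ n, 0 < c n) (hc : ∀ n i, 1 ≤ i → i ≤ n → c n * w n i = p i * c (n - i)) {l : ℕ}
    (hl : 1 ≤ l) {u : ℕ → ℝ} (hu0 : u 0 = 1)
    (hu : ∀ n, u (n + 1) = ∑ i ∈ Finset.range (n + 1), p (i + 1) * u (n - i)) (d : ℕ) :
    Tendsto (fun n => (Nat.card {x : X n // N n x (n - 1 - d) = l} : ℝ) / Nat.card (X n)) atTop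
      (𝓝 (p l * if d = 0 then 1 / 2 else u d)) := by
  refine ((h.peeling hc0 hc hl).tendsto_fixed_compl hp hl hu0 hu d).congr' ?_
  filter_upwards [eventually_ge_atTop 2] with n hn
  rw [h.ratio_eq hcpos hn]

/-- The point probabilities are eventually dominated by a multiple of the block law. -/
theorem exists_ratio_le (h : PeelableClass X N w) (hp : BlockLaw p m) (hc0 : c 0 = 1)
    (hcpos : ∀ n, 0 < c n) (hc : ∀ n i, 1 ≤ i → i ≤ n → c n * w n i = p i * c (n - i)) :
    ∃ C : ℝ, ∀ᶠ n in atTop, ∀ d l, d < n → 1 ≤ l →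
      (Nat.card {x : X n // N n x d = l} : ℝ) / Nat.card (X n) ≤ C * p l := by
  have h1 := h.peeling hc0 hc le_rfl
  have hv := Peeling.limit_pos hp
  -- The weighted count is at most `2 * p l`, and `V n` eventually exceeds half of its limit `(1 - p
  -- 1) / m`.
  refine ⟨2 / ((1 - p 1) / m), ?_⟩
  filter_upwards [eventually_ge_atTop 2, (hp.tendsto_renewal h1.zero h1.one h1.renewal).2.eventually
    (lt_mem_nhds (half_lt_self hv))] with n hn hV d l hd hl
  have h2 := (h.peeling hc0 hc hl).add_le hp hl hn hd
  have hpl : 0 < p l := by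
    obtain ⟨k, rfl⟩ := Nat.exists_eq_add_of_le' hl
    exact hp.pos k
  rw [h.ratio_eq hcpos hn, div_le_iff₀ (by linarith)]
  refine h2.trans ?_
  rw [mul_right_comm, mul_comm 2 (p l), mul_comm _ (p l)]
  refine mul_le_mul_of_nonneg_left ?_ hpl.le
  rw [div_mul_eq_mul_div, le_div_iff₀ hv]
  linarith

end asymptotics

end PeelableClass

/-! ### Degree counts -/

/-- The set of isolated vertices. -/
def isolSet {V : Type*} (G : SimpleGraph V) : Set V := {v | ∀ w, ¬G.Adj v w}

lemma mem_isolSet {V : Type*} {G : SimpleGraph V} {v : V} : v ∈ isolSet G ↔ ∀ w, ¬G.Adj v w :=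
  Iff.rfl

lemma degreeCount_eq_ncard {V : Type*} [Fintype V] (G : SimpleGraph V) (d : ℕ) :
    degreeCount G d = {v : V | (G.neighborSet v).ncard = d}.ncard := by
  classical
  unfold degreeCount
  rw [← Set.ncard_coe_finset]
  congr 1
  ext v
  simp only [Finset.coe_filter, Finset.mem_univ, true_and, Set.mem_ofPred_eq]
  rw [← SimpleGraph.card_neighborSet_eq_degree, ← Nat.card_eq_fintype_card, Nat.card_coe_set_eq]

lemma ncard_neighborSet_eq_zero {V : Type*} [Finite V] {G : SimpleGraph V} {v : V} :
    (G.neighborSet v).ncard = 0 ↔ v ∈ isolSet G := by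
  rw [Set.ncard_eq_zero (Set.toFinite _), Set.eq_empty_iff_forall_notMem]
  rfl

lemma degreeCount_zero {V : Type*} [Fintype V] (G : SimpleGraph V) :
    degreeCount G 0 = (isolSet G).ncard := by
  rw [degreeCount_eq_ncard]
  congr 1
  ext v
  exact ncard_neighborSet_eq_zero

lemma degreeCount_zero_eq_zero {V : Type*} [Fintype V] (G : SimpleGraph V) :
    degreeCount G 0 = 0 ↔ isolSet G = ∅ := by
  rw [degreeCount_zero, Set.ncard_eq_zero (Set.toFinite _)]

lemma degreeCount_le {V : Type*} [Fintype V] (G : SimpleGraph V) (d : ℕ) :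
    degreeCount G d ≤ Fintype.card V :=
  Finset.card_le_univ _

lemma degreeCount_eq_zero_of_le {V : Type*} [Fintype V] (G : SimpleGraph V) {d : ℕ}
    (hd : Fintype.card V ≤ d) : degreeCount G d = 0 := by
  classical
  rw [degreeCount, Finset.card_eq_zero, Finset.filter_eq_empty_iff]
  intro v _
  have := G.degree_lt_card_verts v
  intro h
  have h2 : G.degree v = d := by convert h
  omega

lemma degreeCount_compl {V : Type*} [Fintype V] (G : SimpleGraph V) {d : ℕ}
    (hd : d < Fintype.card V) :
    degreeCount Gᶜ d = degreeCount G (Fintype.card V - 1 - d) := by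
  classical
  rw [degreeCount_eq_ncard, degreeCount_eq_ncard]
  congr 1
  ext v
  simp only [Set.mem_ofPred_eq]
  have h1 := G.degree_compl v
  have h2 := G.degree_lt_card_verts v
  rw [← SimpleGraph.card_neighborSet_eq_degree, ← Nat.card_eq_fintype_card,
    Nat.card_coe_set_eq] at h1
  have h3 : G.degree v = (G.neighborSet v).ncard := by
    rw [← SimpleGraph.card_neighborSet_eq_degree, ← Nat.card_eq_fintype_card, Nat.card_coe_set_eq]
  rw [h1, ← h3]
  omega

/-! ### Enlarging a graph by isolated vertices -/

section map

variable {V W : Type*} {G : SimpleGraph W}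

lemma neighborSet_map (f : W ↪ V) (w : W) :
    (G.map f).neighborSet (f w) = f '' G.neighborSet w := by
  ext v
  simp only [SimpleGraph.mem_neighborSet, SimpleGraph.map_adj, Set.mem_image]
  constructor
  · rintro ⟨a, b, hab, ha, rfl⟩
    exact ⟨b, f.injective ha ▸ hab, rfl⟩
  · rintro ⟨b, hb, rfl⟩
    exact ⟨w, b, hb, rfl, rfl⟩

lemma notMem_isolSet_map (f : W ↪ V) {v : V} (hv : v ∉ isolSet (G.map f)) : v ∈ Set.range f := by
  simp only [mem_isolSet, not_forall, not_not] at hv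
  obtain ⟨w, hw⟩ := hv
  obtain ⟨a, b, -, rfl, -⟩ := (SimpleGraph.map_adj f G v w).1 hw
  exact ⟨a, rfl⟩

lemma mem_isolSet_map (f : W ↪ V) (w : W) : f w ∈ isolSet (G.map f) ↔ w ∈ isolSet G := by
  constructor
  · intro h b hb
    exact h (f b) (SimpleGraph.map_adj_apply.2 hb)
  · intro h v hv
    obtain ⟨a, b, hab, ha, -⟩ := (SimpleGraph.map_adj f G _ _).1 hv
    exact h b (f.injective ha ▸ hab)

lemma isolSet_map (f : W ↪ V) (hG : isolSet G = ∅) : isolSet (G.map f) = (Set.range f)ᶜ := by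
  ext v
  constructor
  · rintro h ⟨w, rfl⟩
    rw [mem_isolSet_map, hG] at h
    exact h
  · intro h
    by_contra h2
    exact h (notMem_isolSet_map f h2)

lemma degreeCount_map [Fintype V] [Fintype W] (f : W ↪ V) {d : ℕ} (hd : 1 ≤ d) :
    degreeCount (G.map f) d = degreeCount G d := by
  rw [degreeCount_eq_ncard, degreeCount_eq_ncard, ← Set.ncard_image_of_injective _ f.injective]
  congr 1
  ext v
  simp only [Set.mem_ofPred_eq, Set.mem_image]
  constructor
  · intro h
    have hv : v ∉ isolSet (G.map f) := by
      rw [← ncard_neighborSet_eq_zero]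
      omega
    obtain ⟨w, rfl⟩ := notMem_isolSet_map f hv
    rw [neighborSet_map, Set.ncard_image_of_injective _ f.injective] at h
    exact ⟨w, h, rfl⟩
  · rintro ⟨w, h, rfl⟩
    rw [neighborSet_map, Set.ncard_image_of_injective _ f.injective, h]

lemma map_comap_of_isolSet {H : SimpleGraph V} (f : W ↪ V) (hf : (Set.range f)ᶜ ⊆ isolSet H) :
    (H.comap f).map f = H := by
  ext a b
  rw [SimpleGraph.map_adj]
  constructor
  · rintro ⟨a, b, h, rfl, rfl⟩
    exact h
  · intro h
    have ha : a ∈ Set.range f := by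
      by_contra h2
      exact hf h2 b h
    have hb : b ∈ Set.range f := by
      by_contra h2
      exact hf h2 a h.symm
    obtain ⟨a, rfl⟩ := ha
    obtain ⟨b, rfl⟩ := hb
    exact ⟨a, b, h, rfl, rfl⟩

end map

/-! ### Closure properties of threshold graphs -/

section threshold

variable {V W : Type*}

lemma IsThreshold.comap {H : SimpleGraph V} (hH : IsThreshold H) (f : W ↪ V) :
    IsThreshold (H.comap f) := by
  obtain ⟨w, t, h⟩ := hH
  exact ⟨w ∘ f, t, fun i j hij => h (f i) (f j) (f.injective.ne hij)⟩

lemma IsThreshold.map [Finite W] {G : SimpleGraph W} (hG : IsThreshold G) (f : W ↪ V) :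
    IsThreshold (G.map f) := by
  classical
  obtain ⟨w, t, h⟩ := hG
  obtain ⟨B, hB⟩ := (Set.finite_range fun i => |w i|).bddAbove
  replace hB : ∀ i, |w i| ≤ B := fun i => hB ⟨i, rfl⟩
  set B' := max B 0 with hB'
  -- A new vertex is so light that its sum with any other weight is at most `-|t|`, hence at most
  -- `t`.
  set w' : V → ℝ := fun v => if hv : v ∈ Set.range f then w hv.choose else -(B' + |t|) with hw'
  have hwf : ∀ i, w' (f i) = w i := by
    intro i
    have hi : f i ∈ Set.range f := ⟨i, rfl⟩
    simp only [hw', dif_pos hi]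
    exact congrArg w (f.injective hi.choose_spec)
  have hwn : ∀ v, v ∉ Set.range f → w' v = -(B' + |t|) := fun v hv => by
    simp only [hw', dif_neg hv]
  have h0 : 0 ≤ B' := le_max_right _ _
  have hle : ∀ v, w' v ≤ B' := by
    intro v
    by_cases hv : v ∈ Set.range f
    · obtain ⟨i, rfl⟩ := hv
      rw [hwf]
      exact (le_abs_self _).trans ((hB i).trans (le_max_left _ _))
    · rw [hwn v hv]
      linarith [abs_nonneg t]
  have hlow : ∀ u v, u ∉ Set.range f → ¬t < w' u + w' v := by
    intro u v hu
    rw [hwn u hu]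
    linarith [hle v, neg_abs_le t]
  refine ⟨w', t, fun u v huv => ?_⟩
  by_cases hu : u ∈ Set.range f
  · by_cases hv : v ∈ Set.range f
    · obtain ⟨i, rfl⟩ := hu
      obtain ⟨j, rfl⟩ := hv
      rw [hwf, hwf, ← h i j fun e => huv (e ▸ rfl)]
      exact SimpleGraph.map_adj_apply
    · have h1 := hlow v u hv
      rw [add_comm] at h1
      refine iff_of_false (fun h2 => hv ?_) h1
      obtain ⟨_, b, _, _, rfl⟩ := (SimpleGraph.map_adj f G _ _).1 h2
      exact ⟨b, rfl⟩
  · refine iff_of_false (fun h2 => hu ?_) (hlow u v hu)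
    obtain ⟨a, _, _, rfl, _⟩ := (SimpleGraph.map_adj f G _ _).1 h2
    exact ⟨a, rfl⟩

/-- Negating weights turns non-adjacency into a non-strict inequality. Finiteness leaves room to
raise the threshold to some `s > t` not above any pair sum exceeding `t`, which makes it strict. -/
lemma IsThreshold.compl [Finite V] {G : SimpleGraph V} (hG : IsThreshold G) :
    IsThreshold Gᶜ := by
  obtain ⟨w, t, h⟩ := hG
  have hev : ∀ᶠ s in 𝓝[>] t, ∀ q : V × V, t < w q.1 + w q.2 → s ≤ w q.1 + w q.2 := by
    rw [eventually_all]
    intro q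
    by_cases hq : t < w q.1 + w q.2
    · filter_upwards [Ioo_mem_nhdsGT hq] with s hs _
      exact hs.2.le
    · exact Eventually.of_forall fun s h2 => absurd h2 hq
  obtain ⟨s, hs, hts⟩ := (hev.and self_mem_nhdsWithin).exists
  refine ⟨fun v => -w v, -s, fun i j hij => ?_⟩
  have h1 := hs (i, j)
  simp only at h1
  rw [SimpleGraph.compl_adj, h i j hij]
  have hts' : t < s := hts
  constructor
  · rintro ⟨-, h2⟩
    linarith [not_lt.1 h2]
  · intro h2
    refine ⟨hij, fun h3 => ?_⟩
    linarith [h1 h3]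

/-- A threshold graph has an isolated or a dominating vertex. -/
lemma IsThreshold.exists_isol_or_dom [Finite V] [Nonempty V] {G : SimpleGraph V}
    (hG : IsThreshold G) : (isolSet G).Nonempty ∨ (isolSet Gᶜ).Nonempty := by
  obtain ⟨w, t, h⟩ := hG
  obtain ⟨u, hu⟩ := Finite.exists_min w
  obtain ⟨v, hv⟩ := Finite.exists_max w
  -- The lightest and heaviest vertices decide: above the threshold the heaviest dominates,
  -- otherwise the lightest is isolated.
  by_cases ht : t < w u + w v
  · refine Or.inr ⟨v, fun x hx => ?_⟩
    rw [SimpleGraph.compl_adj, h v x hx.1] at hx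
    exact hx.2 (by linarith [hu x])
  · refine Or.inl ⟨u, fun x hx => ht ?_⟩
    have := (h u x hx.ne).1 hx
    linarith [hv x]

lemma isolSet_compl_eq_empty [Nontrivial V] {G : SimpleGraph V} (hG : (isolSet G).Nonempty) :
    isolSet Gᶜ = ∅ := by
  obtain ⟨u, hu⟩ := hG
  rw [Set.eq_empty_iff_forall_notMem]
  intro v hv
  by_cases huv : u = v
  · subst huv
    obtain ⟨x, hx⟩ := exists_ne u
    exact hv x (by rw [SimpleGraph.compl_adj]; exact ⟨hx.symm, hu x⟩)
  · exact hv u (by rw [SimpleGraph.compl_adj]; exact ⟨Ne.symm huv, fun h => hu v h.symm⟩)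

lemma IsThreshold.degreeCount_dichotomy [Fintype V] (hV : 2 ≤ Fintype.card V) {G : SimpleGraph V}
    (hG : IsThreshold G) :
    degreeCount G 0 = 0 ↔ degreeCount G (Fintype.card V - 1) ≠ 0 := by
  have : Nontrivial V := Fintype.one_lt_card_iff_nontrivial.1 hV
  have h1 := degreeCount_compl G (d := 0) (by omega)
  rw [Nat.sub_zero] at h1
  rw [← h1, Ne, degreeCount_zero_eq_zero, degreeCount_zero_eq_zero]
  constructor
  · intro h2
    rcases hG.exists_isol_or_dom with h3 | h3
    · exact absurd h2 h3.ne_empty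
    · exact h3.ne_empty
  · intro h2
    by_contra h3
    exact h2 (isolSet_compl_eq_empty (Set.nonempty_iff_ne_empty.2 h3))

end threshold

/-! ### Labeled threshold graphs -/

lemma exists_embedding_range_compl {n i : ℕ} (S : Set (Fin n)) (hS : S.ncard = i) :
    ∃ f : Fin (n - i) ↪ Fin n, Set.range f = Sᶜ := by
  have h1 : Nat.card ↥Sᶜ = n - i := by
    have := Set.ncard_add_ncard_compl S
    rw [Nat.card_eq_fintype_card, Fintype.card_fin] at this
    rw [Nat.card_coe_set_eq]
    omega
  have e : Fin (n - i) ≃ ↥Sᶜ := (Finite.equivFinOfCardEq h1).symm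
  refine ⟨e.toEmbedding.trans (Function.Embedding.subtype _), ?_⟩
  ext v
  simp only [Set.mem_range, Function.Embedding.trans_apply, Equiv.coe_toEmbedding]
  constructor
  · rintro ⟨k, rfl⟩
    exact (e k).2
  · intro hv
    exact ⟨e.symm ⟨v, hv⟩, by simp⟩

/-- The threshold graphs with a given set of isolated vertices are the extensions of the threshold
graphs without isolated vertices on the complement. -/
def isolSetEquiv {n i : ℕ} (S : Set (Fin n)) (f : Fin (n - i) ↪ Fin n) (hf : Set.range f = Sᶜ)
    {d : ℕ} (hd : 1 ≤ d) (l : ℕ) :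
    {G : Labeled n // isolSet G.1 = S ∧ countLabeled d G = l} ≃
      {G : Labeled (n - i) // countLabeled 0 G = 0 ∧ countLabeled d G = l} where
  toFun G := ⟨⟨G.1.1.comap f, G.1.2.comap f⟩, by
    have h1 : (G.1.1.comap f).map f = G.1.1 :=
      map_comap_of_isolSet f (by rw [hf, compl_compl, G.2.1])
    constructor
    · refine (degreeCount_zero_eq_zero _).2 (Set.eq_empty_iff_forall_notMem.2 fun w hw => ?_)
      rw [← mem_isolSet_map f, h1, G.2.1] at hw
      have h2 : f w ∈ Sᶜ := hf ▸ ⟨w, rfl⟩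
      exact h2 hw
    · refine Eq.trans ?_ G.2.2
      exact (degreeCount_map f hd).symm.trans (by rw [h1]; rfl)⟩
  invFun G := ⟨⟨G.1.1.map f, G.1.2.map f⟩, by
    constructor
    · change isolSet (G.1.1.map f) = S
      rw [isolSet_map f ((degreeCount_zero_eq_zero _).1 G.2.1), hf, compl_compl]
    · exact (degreeCount_map f hd).trans G.2.2⟩
  left_inv G := by
    refine Subtype.ext (Subtype.ext ?_)
    exact map_comap_of_isolSet f (by rw [hf, compl_compl, G.2.1])
  right_inv G := by
    refine Subtype.ext (Subtype.ext ?_)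
    exact SimpleGraph.comap_map_eq f G.1.1

/-- The complement of a labeled threshold graph. -/
def Labeled.compl {n : ℕ} : Labeled n ≃ Labeled n where
  toFun G := ⟨G.1ᶜ, G.2.compl⟩
  invFun G := ⟨G.1ᶜ, G.2.compl⟩
  left_inv G := Subtype.ext (compl_compl G.1)
  right_inv G := Subtype.ext (compl_compl G.1)

theorem peelableClass_labeled :
    PeelableClass Labeled (fun _ G d => countLabeled d G) Nat.choose where
  fiber n i d l hi hd := by
    classical
    -- Graphs are sorted by their isolated set, one of `n.choose i` subsets; by `isolSetEquiv` all
    -- fibers have the same size.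
    let e : {G : Labeled n // countLabeled 0 G = i ∧ countLabeled d G = l} ≃
        Σ S : {S : Finset (Fin n) // S ∈ Finset.univ.powersetCard i},
          {G : Labeled n // isolSet G.1 = (S.1 : Set (Fin n)) ∧ countLabeled d G = l} :=
      { toFun := fun G => ⟨⟨(isolSet G.1.1).toFinset, by
          rw [Finset.mem_powersetCard_univ, ← Set.ncard_eq_toFinset_card', ← degreeCount_zero]
          exact G.2.1⟩, G.1, by simp, G.2.2⟩
        invFun := fun T => ⟨T.2.1, by
          have h1 := T.1.2
          rw [Finset.mem_powersetCard_univ] at h1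
          refine ⟨?_, T.2.2.2⟩
          rw [countLabeled, degreeCount_zero, T.2.2.1, Set.ncard_coe_finset, h1]⟩
        left_inv := fun G => rfl
        right_inv := by
          rintro ⟨⟨S, hS⟩, G, h1, h2⟩
          have : (isolSet G.1).toFinset = S := by
            ext v
            simp [h1]
          subst this
          rfl }
    have hfib : ∀ S : {S : Finset (Fin n) // S ∈ Finset.univ.powersetCard i},
        Nat.card {G : Labeled n // isolSet G.1 = (S.1 : Set (Fin n)) ∧ countLabeled d G = l}
          = Nat.card {G : Labeled (n - i) // countLabeled 0 G = 0 ∧ countLabeled d G = l} := by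
      intro S
      obtain ⟨f, hf⟩ := exists_embedding_range_compl (i := i) (S.1 : Set (Fin n)) (by
        rw [Set.ncard_coe_finset]
        exact (Finset.mem_powersetCard_univ.1 S.2))
      exact Nat.card_congr (isolSetEquiv _ f hf hd l)
    rw [Nat.card_congr e, Nat.card_sigma, Finset.sum_congr rfl fun S _ => hfib S]
    simp
  compl n := ⟨Labeled.compl, fun G d hd => by
    have := degreeCount_compl G.1 (d := d) (by simpa using hd)
    rwa [Fintype.card_fin] at this⟩
  dichotomy n G hn := by
    have := G.2.degreeCount_dichotomy (by simpa using hn)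
    rwa [Fintype.card_fin] at this
  le n G d := (degreeCount_le G.1 d).trans_eq (Fintype.card_fin n)
  vanish n G d hd := degreeCount_eq_zero_of_le G.1 (by simpa using hd)
  card_zero := by
    rw [Nat.card_eq_one_iff_unique]
    exact ⟨⟨fun G H => Subtype.ext (Subsingleton.elim _ _)⟩, inferInstance⟩
  one G := by
    rw [Ne, countLabeled, degreeCount_zero_eq_zero, Set.eq_empty_iff_forall_notMem]
    intro h
    exact h 0 fun w hw => hw.ne (Subsingleton.elim _ _)

/-! ### Unlabeled threshold graphs -/

/-- The added vertices are exactly the isolated ones, and isomorphisms preserve isolation, so the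
isomorphism restricts to the cores. -/
lemma nonempty_iso_of_map {V V' W W' : Type*} {G : SimpleGraph W} {H : SimpleGraph W'}
    (f : W ↪ V) (g : W' ↪ V') (hG : isolSet G = ∅) (hH : isolSet H = ∅)
    (e : G.map f ≃g H.map g) : Nonempty (G ≃g H) := by
  have hiff : ∀ a, a ∈ Set.range f ↔ e a ∈ Set.range g := by
    intro a
    have h1 : a ∈ isolSet (G.map f) ↔ e a ∈ isolSet (H.map g) := by
      constructor
      · intro h v hv
        refine h (e.symm v) ?_
        rw [← e.map_adj_iff]
        simpa using hv
      · intro h v hv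
        exact h (e v) (e.map_adj_iff.2 hv)
    rw [isolSet_map f hG, isolSet_map g hH, Set.mem_compl_iff, Set.mem_compl_iff] at h1
    exact not_iff_not.1 h1
  let E : W ≃ W' := (Equiv.ofInjective f f.injective).trans
    ((e.toEquiv.subtypeEquiv hiff).trans (Equiv.ofInjective g g.injective).symm)
  have hE : ∀ a, g (E a) = e (f a) := by
    intro a
    exact Equiv.apply_ofInjective_symm g.injective _
  refine ⟨⟨E, fun {a b} => ?_⟩⟩
  rw [← SimpleGraph.map_adj_apply (f := g), hE, hE, e.map_adj_iff, SimpleGraph.map_adj_apply]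

/-- Two embeddings of a finite set into the same set differ by a permutation of the target. -/
lemma nonempty_iso_map_map {V W : Type*} [Finite W] (G : SimpleGraph W) (f g : W ↪ V) :
    Nonempty (G.map f ≃g G.map g) := by
  obtain ⟨σ, hσ⟩ := Equiv.Perm.exists_extending_pair f g f.injective g.injective
  have h : (G.map f).map σ = G.map g := by
    rw [SimpleGraph.map_map]
    congr 1
    exact funext hσ
  exact ⟨h ▸ SimpleGraph.Iso.map σ (G.map f)⟩

lemma nonempty_iso_map {V W W' : Type*} {G : SimpleGraph W} {H : SimpleGraph W'} (e : G ≃g H)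
    (f : W ↪ V) (g : W' ↪ V) [Finite W] : Nonempty (G.map f ≃g H.map g) := by
  obtain ⟨e'⟩ := nonempty_iso_map_map G f (e.toEquiv.toEmbedding.trans g)
  have h : G.map (e.toEquiv.toEmbedding.trans g) = H.map g := by
    ext a b
    simp only [SimpleGraph.map_adj]
    constructor
    · rintro ⟨x, y, hxy, rfl, rfl⟩
      exact ⟨e x, e y, e.map_adj_iff.2 hxy, rfl, rfl⟩
    · rintro ⟨x, y, hxy, rfl, rfl⟩
      refine ⟨e.symm x, e.symm y, e.symm.map_adj_iff.2 hxy, ?_, ?_⟩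
      · exact congrArg g (e.apply_symm_apply x)
      · exact congrArg g (e.apply_symm_apply y)
  exact ⟨h ▸ e'⟩

/-- Extension of a labeled threshold graph by isolated vertices. -/
def Labeled.extend {m n : ℕ} (f : Fin m ↪ Fin n) (G : Labeled m) : Labeled n :=
  ⟨G.1.map f, G.2.map f⟩

/-- Extension of an unlabeled threshold graph by isolated vertices. -/
def Unlabeled.extend {m n : ℕ} (f : Fin m ↪ Fin n) : Unlabeled m → Unlabeled n :=
  Quotient.map' (s₁ := labeledSetoid m) (s₂ := labeledSetoid n) (Labeled.extend f)
    fun _ _ ⟨e⟩ => nonempty_iso_map e f f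

lemma Labeled.countLabeled_zero_extend {m n : ℕ} (f : Fin m ↪ Fin n) {G : Labeled m}
    (hG : countLabeled 0 G = 0) : countLabeled 0 (G.extend f) = n - m := by
  have h1 := isolSet_map f ((degreeCount_zero_eq_zero G.1).1 hG)
  have h2 : countLabeled 0 (G.extend f) = (isolSet (G.1.map f)).ncard := degreeCount_zero _
  have h3 := Set.ncard_add_ncard_compl (Set.range f)
  have h4 : (Set.range f).ncard = m := by
    rw [← Set.image_univ, Set.ncard_image_of_injective _ f.injective, Set.ncard_univ]
    simp
  rw [Nat.card_eq_fintype_card, Fintype.card_fin] at h3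
  rw [h2, h1]
  omega

/-- The complement of an unlabeled threshold graph. -/
def Unlabeled.compl {n : ℕ} : Unlabeled n ≃ Unlabeled n :=
  Quotient.congr (ra := labeledSetoid n) (rb := labeledSetoid n) Labeled.compl fun G H => by
    constructor
    · rintro ⟨e⟩
      exact ⟨⟨e.toEquiv, fun {a b} => by
        change H.1ᶜ.Adj (e a) (e b) ↔ G.1ᶜ.Adj a b
        rw [SimpleGraph.compl_adj, SimpleGraph.compl_adj, e.map_adj_iff, e.injective.ne_iff]⟩⟩
    · rintro ⟨e⟩
      refine ⟨⟨e.toEquiv, fun {a b} => ?_⟩⟩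
      change H.1.Adj (e a) (e b) ↔ G.1.Adj a b
      have h1 : H.1ᶜ.Adj (e a) (e b) ↔ G.1ᶜ.Adj a b := e.map_adj_iff
      rw [SimpleGraph.compl_adj, SimpleGraph.compl_adj, e.injective.ne_iff] at h1
      by_cases hab : a = b
      · subst hab
        simp
      · simpa [hab, not_iff_not] using h1

theorem peelableClass_unlabeled :
    PeelableClass Unlabeled (fun _ U d => countUnlabeled d U) (fun _ _ => 1) where
  fiber n i d l hi hd := by
    rw [one_mul]
    symm
    -- Any embedding will do: up to isomorphism, extension by `i` isolated vertices is independent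
    -- of it and is undone by deleting them. This bijection accounts for the weight `1`.
    let f : Fin (n - i) ↪ Fin n := Fin.castLEEmb (Nat.sub_le n i)
    refine Nat.card_congr (Equiv.ofBijective (fun U => ⟨Unlabeled.extend f U.1, ?_⟩) ⟨?_, ?_⟩)
    · obtain ⟨U, hU⟩ := U
      induction U using Quotient.inductionOn with
      | _ G =>
        refine ⟨(Labeled.countLabeled_zero_extend f hU.1).trans (by omega), ?_⟩
        exact (degreeCount_map f hd).trans hU.2
    · rintro ⟨U, hU⟩ ⟨U', hU'⟩ h
      have h' := congrArg Subtype.val h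
      refine Subtype.ext ?_
      clear h
      induction U using Quotient.inductionOn with
      | _ G =>
        induction U' using Quotient.inductionOn with
        | _ G' =>
          obtain ⟨e⟩ := Quotient.exact (s := labeledSetoid n) h'
          exact Quotient.sound (s := labeledSetoid (n - i)) (nonempty_iso_of_map f f
            ((degreeCount_zero_eq_zero _).1 hU.1) ((degreeCount_zero_eq_zero _).1 hU'.1) e)
    · rintro ⟨U, hU⟩
      induction U using Quotient.inductionOn with
      | _ H =>
        have h1 : (isolSet H.1).ncard = i := (degreeCount_zero H.1).symm.trans hU.1
        obtain ⟨g, hg⟩ := exists_embedding_range_compl _ h1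
        let G := isolSetEquiv (isolSet H.1) g hg hd l ⟨H, rfl, hU.2⟩
        have h2 : (H.1.comap g).map g = H.1 :=
          map_comap_of_isolSet g (by rw [hg, compl_compl])
        refine ⟨⟨Quotient.mk (labeledSetoid (n - i)) G.1, G.2⟩, Subtype.ext ?_⟩
        refine Quotient.sound (s := labeledSetoid n) ?_
        obtain ⟨e⟩ := nonempty_iso_map_map (H.1.comap g) f g
        rw [h2] at e
        exact ⟨e⟩
  compl n := ⟨Unlabeled.compl, fun U d hd => by
    induction U using Quotient.inductionOn with
    | _ G =>
      have := degreeCount_compl G.1 (d := d) (by simpa using hd)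
      rwa [Fintype.card_fin] at this⟩
  dichotomy n U hn := by
    induction U using Quotient.inductionOn with
    | _ G => exact peelableClass_labeled.dichotomy n G hn
  le n U d := by
    induction U using Quotient.inductionOn with
    | _ G => exact peelableClass_labeled.le n G d
  vanish n U d hd := by
    induction U using Quotient.inductionOn with
    | _ G => exact peelableClass_labeled.vanish n G d hd
  card_zero := by
    rw [Nat.card_eq_one_iff_unique]
    have : Subsingleton (Labeled 0) := ⟨fun G H => Subtype.ext (Subsingleton.elim _ _)⟩
    exact ⟨inferInstanceAs (Subsingleton (Quotient (labeledSetoid 0))), inferInstance⟩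
  one U := by
    induction U using Quotient.inductionOn with
    | _ G => exact peelableClass_labeled.one G

/-! ### Dominated convergence of laws on the natural numbers -/

lemma integrable_nat_iff (ν : Measure ℕ) [IsFiniteMeasure ν] (g : ℕ → ℝ) :
    Integrable g ν ↔ Summable fun l => ν.real {l} * |g l| := by
  conv_lhs => rw [← Measure.sum_smul_dirac ν]
  rw [integrable_sum_dirac_iff fun l => measure_ne_top ν {l}]
  rfl

lemma integral_nat (ν : Measure ℕ) [IsFiniteMeasure ν] (g : ℕ → ℝ) :
    ∫ l, g l ∂ν = ∑' l, ν.real {l} * g l := by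
  conv_lhs => rw [← Measure.sum_smul_dirac ν]
  rw [integral_sum_dirac fun l => measure_ne_top ν {l}]
  rfl

section dominated

variable {ρ : ℕ → Measure ℕ} {ν : Measure ℕ} {b : ℕ → ℝ}

lemma real_singleton_le_of_tendsto (hdom : ∀ᶠ n in atTop, ∀ l, 1 ≤ l → (ρ n).real {l} ≤ b l)
    (hlim : ∀ l, 1 ≤ l → Tendsto (fun n => (ρ n).real {l}) atTop (𝓝 (ν.real {l}))) {l : ℕ}
    (hl : 1 ≤ l) : ν.real {l} ≤ b l :=
  le_of_tendsto (hlim l hl) (hdom.mono fun _ h => h l hl)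

lemma summable_of_dominated (μ : Measure ℕ) {g : ℕ → ℝ} (hμ : ∀ l, 1 ≤ l → μ.real {l} ≤ b l)
    (hg : Summable fun l => b (l + 1) * |g (l + 1)|) : Summable fun l => μ.real {l} * |g l| := by
  rw [← summable_nat_add_iff 1]
  refine Summable.of_nonneg_of_le (fun l => by positivity) (fun l => ?_) hg
  exact mul_le_mul_of_nonneg_right (hμ (l + 1) (by omega)) (abs_nonneg _)

/-- Dominated convergence over `l ≥ 1` only; the atom at `0` is recovered from total mass one. -/
lemma tendsto_integral_of_dominated [∀ n, IsProbabilityMeasure (ρ n)] [IsProbabilityMeasure ν]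
    (hdom : ∀ᶠ n in atTop, ∀ l, 1 ≤ l → (ρ n).real {l} ≤ b l)
    (hlim : ∀ l, 1 ≤ l → Tendsto (fun n => (ρ n).real {l}) atTop (𝓝 (ν.real {l})))
    (hb : Summable fun l => b (l + 1)) {g : ℕ → ℝ}
    (hg : Summable fun l => b (l + 1) * |g (l + 1)|) :
    Tendsto (fun n => ∫ l, g l ∂(ρ n)) atTop (𝓝 (∫ l, g l ∂ν)) := by
  have hν : ∀ l, 1 ≤ l → ν.real {l} ≤ b l := fun l hl => real_singleton_le_of_tendsto hdom hlim hl
  have hsplit : ∀ (μ : Measure ℕ) [IsProbabilityMeasure μ] (g : ℕ → ℝ),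
      (∀ l, 1 ≤ l → μ.real {l} ≤ b l) → (Summable fun l => b (l + 1) * |g (l + 1)|) →
      ∫ l, g l ∂μ = μ.real {0} * g 0 + ∑' l, μ.real {l + 1} * g (l + 1) := by
    intro μ _ g hμ hg
    rw [integral_nat, Summable.tsum_eq_zero_add]
    refine Summable.of_norm ?_
    refine (summable_of_dominated μ hμ hg).congr fun l => ?_
    rw [Real.norm_eq_abs, abs_mul, abs_of_nonneg measureReal_nonneg]
  have htail : ∀ (g : ℕ → ℝ), (Summable fun l => b (l + 1) * |g (l + 1)|) →
      Tendsto (fun n => ∑' l, (ρ n).real {l + 1} * g (l + 1)) atTop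
        (𝓝 (∑' l, ν.real {l + 1} * g (l + 1))) := by
    intro g hg
    refine tendsto_tsum_of_dominated_convergence hg
      (fun l => (hlim (l + 1) (by omega)).mul_const _) ?_
    filter_upwards [hdom] with n hn l
    rw [Real.norm_eq_abs, abs_mul, abs_of_nonneg measureReal_nonneg]
    exact mul_le_mul_of_nonneg_right (hn (l + 1) (by omega)) (abs_nonneg _)
  have hone : ∀ (μ : Measure ℕ) [IsProbabilityMeasure μ], (∀ l, 1 ≤ l → μ.real {l} ≤ b l) →
      μ.real {0} = 1 - ∑' l, μ.real {l + 1} * 1 := by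
    intro μ _ hμ
    have := hsplit μ (fun _ => 1) hμ (by simpa using hb)
    simp only [integral_const, probReal_univ, smul_eq_mul, mul_one] at this
    simp only [mul_one]
    linarith
  have hzero : Tendsto (fun n => (ρ n).real {0}) atTop (𝓝 (ν.real {0})) := by
    rw [hone ν hν]
    refine ((htail (fun _ => 1) (by simpa using hb)).const_sub 1).congr' ?_
    filter_upwards [hdom] with n hn
    rw [hone (ρ n) hn]
  rw [hsplit ν g hν hg]
  refine ((hzero.mul_const (g 0)).add (htail g hg)).congr' ?_
  filter_upwards [hdom] with n hn
  rw [hsplit (ρ n) g hn hg]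

end dominated

/-- Pointwise convergence of the point probabilities, dominated by a sequence with all moments,
implies convergence in distribution and of all moments. -/
theorem tendstoWithMoments_of_dominated {Ω : ℕ → Type*} [∀ n, MeasurableSpace (Ω n)]
    [∀ n, DiscreteMeasurableSpace (Ω n)] [∀ n, Finite (Ω n)]
    (μ : (n : ℕ) → Measure (Ω n)) [∀ n, IsProbabilityMeasure (μ n)]
    (X : (n : ℕ) → Ω n → ℕ) (ν : Measure ℕ) [IsProbabilityMeasure ν] {b : ℕ → ℝ}
    (hb : ∀ k : ℕ, Summable fun l : ℕ => b (l + 1) * ((l + 1 : ℕ) : ℝ) ^ k)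
    (hdom : ∀ᶠ n in atTop, ∀ l, 1 ≤ l → (μ n).real {ω | X n ω = l} ≤ b l)
    (hlim : ∀ l, 1 ≤ l → Tendsto (fun n => (μ n).real {ω | X n ω = l}) atTop (𝓝 (ν.real {l}))) :
    TendstoWithMoments μ X ν := by
  have hX : ∀ n, Measurable (X n) := fun n => Measurable.of_discrete
  have hprob : ∀ n, IsProbabilityMeasure ((μ n).map (X n)) := fun n =>
    Measure.isProbabilityMeasure_map (hX n).aemeasurable
  have hmap : ∀ n l, ((μ n).map (X n)).real {l} = (μ n).real {ω | X n ω = l} := by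
    intro n l
    rw [measureReal_def, Measure.map_apply (hX n) (measurableSet_singleton l)]
    rfl
  simp only [← hmap] at hdom hlim
  have hb0 : Summable fun l => b (l + 1) := by simpa using hb 0
  have hbpos : ∀ l, 0 ≤ b (l + 1) := fun l =>
    measureReal_nonneg.trans (real_singleton_le_of_tendsto hdom hlim (by omega : 1 ≤ l + 1))
  have hmom : ∀ k : ℕ, Summable fun l : ℕ => b (l + 1) * |((l + 1 : ℕ) : ℝ) ^ k| := by
    intro k
    refine (hb k).congr fun l => ?_
    rw [abs_of_nonneg (by positivity)]
  refine ⟨⟨fun n => (hX n).aemeasurable, aemeasurable_id, ?_⟩, ?_, ?_, ?_⟩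
  · refine ProbabilityMeasure.tendsto_iff_forall_integral_tendsto.2 fun f => ?_
    simp only [ProbabilityMeasure.coe_mk, Measure.map_id]
    refine tendsto_integral_of_dominated hdom hlim hb0 ?_
    refine Summable.of_nonneg_of_le (fun l => mul_nonneg (hbpos l) (abs_nonneg _)) (fun l => ?_)
      (hb0.mul_right ‖f‖)
    exact mul_le_mul_of_nonneg_left (f.norm_coe_le_norm _) (hbpos l)
  · exact fun n k => Integrable.of_finite
  · intro k
    rw [integrable_nat_iff]
    exact summable_of_dominated ν (fun l hl => real_singleton_le_of_tendsto hdom hlim hl) (hmom k)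
  · intro k
    refine (tendsto_integral_of_dominated hdom hlim hb0
      (g := fun x : ℕ => (x : ℝ) ^ k) (hmom k)).congr fun n => ?_
    rw [integral_map (hX n).aemeasurable Measurable.of_discrete.aestronglyMeasurable]

lemma uniformOfFintype_real {α : Type*} [Fintype α] [Nonempty α] [MeasurableSpace α]
    [DiscreteMeasurableSpace α] (P : α → Prop) :
    (PMF.uniformOfFintype α).toMeasure.real {x | P x} = (Nat.card {x // P x} : ℝ) / Nat.card α := by
  classical
  rw [measureReal_def, PMF.toMeasure_uniformOfFintype_apply _ MeasurableSet.of_discrete,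
    ENNReal.toReal_div, ENNReal.toReal_natCast, ENNReal.toReal_natCast, Nat.card_eq_fintype_card,
    Nat.card_eq_fintype_card]
  rfl

instance (n : ℕ) : DiscreteMeasurableSpace (Labeled n) := ⟨fun _ => trivial⟩

instance (n : ℕ) : DiscreteMeasurableSpace (Unlabeled n) := ⟨fun _ => trivial⟩

lemma uniformLabeled_real {n : ℕ} (d l : ℕ) :
    (uniformLabeled n).real {G | countLabeled d G = l}
      = (Nat.card {G : Labeled n // countLabeled d G = l} : ℝ) / Nat.card (Labeled n) :=
  uniformOfFintype_real _

lemma uniformUnlabeled_real {n : ℕ} (d l : ℕ) :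
    (uniformUnlabeled n).real {G | countUnlabeled d G = l}
      = (Nat.card {G : Unlabeled n // countUnlabeled d G = l} : ℝ) / Nat.card (Unlabeled n) :=
  uniformOfFintype_real _

/-! ### The block law of unlabeled threshold graphs -/

lemma blockLaw_geometric : BlockLaw (fun i => (1 / 2 : ℝ) ^ i) 2 where
  pos i := by positivity
  hasSum := by
    have := hasSum_geometric_two.mul_left (1 / 2)
    norm_num at this
    refine hasSum_of_eq (fun i => ?_) this
    rw [pow_succ]
    norm_num
    ring
  hasSum_mean := by
    have h := hasSum_coe_mul_geometric_of_norm_lt_one (𝕜 := ℝ) (r := 1 / 2) (by norm_num)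
    rw [← hasSum_nat_add_iff' 1] at h
    norm_num at h
    refine hasSum_of_eq (fun i => ?_) h
    norm_num

lemma geometricMeasure_half_real (l : ℕ) :
    (geometricMeasure half).real {l} = (1 / 2 : ℝ) ^ l * (1 / 2) := by
  have h : half ≠ 0 := by
    intro h
    have := congrArg Subtype.val h
    norm_num [half] at this
  rw [geometricMeasure_real_singleton h]
  norm_num [half]

/-- Along an ultrafilter the degree, and likewise the codegree, is eventually constant or tends to
infinity. All regimes agree: the geometric law has mean `2`, and its renewal probabilities at
positive indices are all `1 / 2`. -/
lemma tendsto_unlabeled {d : ℕ → ℕ} (hd : ∀ n, 1 ≤ n → d n ≤ n - 1) {l : ℕ} (hl : 1 ≤ l) :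
    Tendsto (fun n => (uniformUnlabeled n).real {G | countUnlabeled (d n) G = l}) atTop
      (𝓝 ((geometricMeasure half).real {l})) := by
  have hc : ∀ n i : ℕ, 1 ≤ i → i ≤ n → (1 / 2 : ℝ) ^ n * ((fun _ _ => 1 : ℕ → ℕ → ℕ) n i : ℕ)
      = (1 / 2 : ℝ) ^ i * (1 / 2 : ℝ) ^ (n - i) := by
    intro n i _ hi
    rw [← pow_add, Nat.add_sub_cancel' hi]
    simp
  have hcpos : ∀ n : ℕ, 0 < (1 / 2 : ℝ) ^ n := fun n => by positivity
  set u : ℕ → ℝ := fun n => if n = 0 then 1 else 1 / 2 with hu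
  have hu0 : u 0 = 1 := rfl
  have hurec : ∀ n, u (n + 1) = ∑ i ∈ Finset.range (n + 1), (1 / 2 : ℝ) ^ (i + 1) * u (n - i) := by
    intro n
    have h1 : ∀ i ∈ Finset.range n, (1 / 2 : ℝ) ^ (i + 1) * u (n - i)
        = (1 / 2) ^ i * (1 / 4) := by
      intro i hi
      rw [Finset.mem_range] at hi
      simp only [hu, if_neg (by omega : n - i ≠ 0)]
      ring
    rw [Finset.sum_range_succ, Finset.sum_congr rfl h1, ← Finset.sum_mul, geom_sum_eq (by norm_num),
      Nat.sub_self, hu0]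
    simp only [hu, if_neg (Nat.succ_ne_zero n)]
    ring
  have hw : ∀ c, (if c = 0 then 1 / 2 else u c) = (1 / 2 : ℝ) := by
    intro c
    simp only [hu]
    split_ifs <;> rfl
  rw [geometricMeasure_half_real]
  simp only [uniformUnlabeled_real]
  have hfix : ∀ c : ℕ, _ := fun c => peelableClass_unlabeled.tendsto_fixed blockLaw_geometric
    (c := fun n => (1 / 2 : ℝ) ^ n) rfl hcpos hc hl hu0 hurec c
  have hfix' : ∀ c : ℕ, _ := fun c => peelableClass_unlabeled.tendsto_fixed_compl
    blockLaw_geometric (c := fun n => (1 / 2 : ℝ) ^ n) rfl hcpos hc hl hu0 hurec c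
  simp only [hw] at hfix hfix'
  rw [tendsto_iff_ultrafilter]
  intro 𝒰 h𝒰
  -- A sequence that does not tend to infinity along an ultrafilter is eventually below some `b`,
  -- hence eventually equal to one of finitely many values.
  have hcases : ∀ e : ℕ → ℕ, Tendsto e 𝒰 atTop ∨ ∃ c, ∀ᶠ n in (𝒰 : Filter ℕ), e n = c := by
    intro e
    by_contra! h
    obtain ⟨h1, h2⟩ := h
    rw [tendsto_atTop] at h1
    push Not at h1
    obtain ⟨b, hb⟩ := h1
    have h3 := (eventually_all_finset (Finset.range b)).2 fun c _ => h2 c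
    obtain ⟨n, hn1, hn2⟩ := (hb.and h3).exists
    exact hn2 (e n) (Finset.mem_range.2 hn1) rfl
  rcases hcases d with h1 | ⟨c, h1⟩
  · rcases hcases (fun n => n - 1 - d n) with h2 | ⟨c, h2⟩
    · exact peelableClass_unlabeled.tendsto_of_atTop blockLaw_geometric
        (c := fun n => (1 / 2 : ℝ) ^ n) rfl hcpos hc hl h𝒰 h1 h2
    · refine ((hfix' c).mono_left h𝒰).congr' ?_
      filter_upwards [h2, h𝒰 (eventually_ge_atTop 1)] with n hn hn1
      have := hd n hn1
      rw [show n - 1 - c = d n by omega]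
  · refine ((hfix c).mono_left h𝒰).congr' ?_
    filter_upwards [h1] with n hn
    rw [hn]

theorem tendstoWithMoments_unlabeled {d : ℕ → ℕ} (hd : ∀ n, 1 ≤ n → d n ≤ n - 1) :
    TendstoWithMoments uniformUnlabeled (fun n => countUnlabeled (d n))
      (geometricMeasure half) := by
  obtain ⟨C, hC⟩ := peelableClass_unlabeled.exists_ratio_le blockLaw_geometric
    (c := fun n => (1 / 2 : ℝ) ^ n) rfl (fun n => by positivity) (fun n i _ hi => by
      rw [← pow_add, Nat.add_sub_cancel' hi]
      simp)
  refine tendstoWithMoments_of_dominated _ _ _ (b := fun l => C * (1 / 2 : ℝ) ^ l) ?_ ?_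
    fun l hl => tendsto_unlabeled hd hl
  · intro k
    have h := (summable_nat_add_iff 1).2
      (summable_pow_mul_geometric_of_norm_lt_one (R := ℝ) k (r := 1 / 2) (by norm_num))
    refine (h.mul_left C).congr fun l => ?_
    ring
  · filter_upwards [hC, eventually_ge_atTop 1] with n hn hn1 l hl
    rw [uniformUnlabeled_real]
    have := hd n hn1
    exact hn (d n) l (by omega) hl

/-! ### The modified Poisson laws -/

lemma modPoisson_real (d : ℕ∞) (l : ℕ) : (modPoisson d).real {l} = modPoissonProb d l := by
  rw [measureReal_def, modPoisson, Measure.sum_smul_dirac_singleton,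
    ENNReal.toReal_ofReal (modPoissonProb_nonneg d l)]

lemma modPoissonProb_of_pos (d : ℕ∞) {l : ℕ} (hl : 1 ≤ l) :
    modPoissonProb d l = gam d * (Real.log 2 ^ (l - 1) / (2 * (l.factorial : ℝ))) := by
  rw [modPoissonProb, if_neg (by omega), mul_div_assoc]

lemma modPoissonProb_eq_mul (d : ℕ∞) {l : ℕ} (hl : 1 ≤ l) :
    modPoissonProb d l
      = Real.log 2 ^ l / (l.factorial : ℝ) * (gam d / (2 * Real.log 2)) := by
  rw [modPoissonProb_of_pos d hl]
  obtain ⟨k, rfl⟩ := Nat.exists_eq_add_of_le' hl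
  have h0 := log_two_pos.ne'
  have := (k + 1).factorial_ne_zero
  rw [Nat.add_sub_cancel, pow_succ]
  field_simp

lemma modPoissonProb_eq_poisson (d : ℕ∞) {l : ℕ} (hl : 1 ≤ l) :
    modPoissonProb d l = gam d / Real.log 2 * (poissonMeasure logTwo).real {l} := by
  rw [modPoissonProb_eq_mul d hl, poissonMeasure_real_singleton]
  have h1 : (logTwo : ℝ) = Real.log 2 := rfl
  rw [h1, Real.exp_neg, Real.exp_log two_pos]
  have h0 := log_two_pos.ne'
  have := l.factorial_ne_zero
  field_simp

/-- Dividing by the block mean `2 log 2` identifies `γ_d` with the factor that the walk produces at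
fixed degree. -/
lemma gam_div (d : ℕ) :
    gam d / (2 * Real.log 2)
      = if d = 0 then 1 / 2 else (prefArr d : ℝ) * Real.log 2 ^ d / d.factorial := by
  have h0 := log_two_pos.ne'
  have := d.factorial_ne_zero
  rw [gam, if_neg (ENat.natCast_ne_top d)]
  simp only [Nat.cast_eq_zero, ENat.toNat_natCast]
  split_ifs
  · field_simp
  · rw [pow_succ]
    field_simp

lemma gam_top : gam ⊤ = 1 := by simp [gam]

lemma hasSum_mean_modPoisson (d : ℕ∞) :
    HasSum (fun l : ℕ => modPoissonProb d l * (l : ℝ)) (gam d) := by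
  have h := NormedSpace.expSeries_div_hasSum_exp (𝔸 := ℝ) (Real.log 2)
  rw [← Real.exp_eq_exp_ℝ, Real.exp_log (by norm_num)] at h
  rw [← hasSum_nat_add_iff' 1]
  have h2 := h.mul_left (gam d / 2)
  rw [div_mul_cancel₀ _ (two_ne_zero)] at h2
  simp only [Finset.sum_range_one, Nat.cast_zero, mul_zero, sub_zero]
  refine hasSum_of_eq (fun l => ?_) h2
  rw [modPoissonProb_of_pos d (by omega), Nat.add_sub_cancel, Nat.factorial_succ]
  have := l.factorial_ne_zero
  have : (l : ℝ) + 1 ≠ 0 := by positivity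
  push_cast
  field_simp

lemma integrable_modPoisson (d : ℕ∞) : Integrable (fun x : ℕ => (x : ℝ)) (modPoisson d) := by
  rw [integrable_nat_iff]
  simpa only [modPoisson_real, Nat.abs_cast] using (hasSum_mean_modPoisson d).summable

lemma integral_modPoisson (d : ℕ∞) : ∫ x : ℕ, (x : ℝ) ∂(modPoisson d) = gam d := by
  rw [integral_nat]
  simpa only [modPoisson_real] using (hasSum_mean_modPoisson d).tsum_eq

/-! ### The block law of labeled threshold graphs -/

/-- The Poisson law conditioned on being nonzero. -/
def expLaw (i : ℕ) : ℝ := Real.log 2 ^ i / (i.factorial : ℝ)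

lemma expLaw_pos (i : ℕ) : 0 < expLaw i := by
  have := log_two_pos
  unfold expLaw
  positivity

lemma blockLaw_expLaw : BlockLaw expLaw (2 * Real.log 2) where
  pos i := expLaw_pos _
  hasSum := hasSum_exp_log_two
  hasSum_mean := by
    have h := NormedSpace.expSeries_div_hasSum_exp (𝔸 := ℝ) (Real.log 2)
    rw [← Real.exp_eq_exp_ℝ, Real.exp_log (by norm_num)] at h
    refine hasSum_of_eq (fun l => ?_) (h.mul_right (Real.log 2))
    have := l.factorial_ne_zero
    have : (l : ℝ) + 1 ≠ 0 := by positivity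
    rw [expLaw, Nat.factorial_succ, pow_succ]
    push_cast
    field_simp

/-- One sequence serves as both block law and normalisation, since exponential weights absorb the
binomial coefficient. -/
lemma expLaw_mul_choose (n i : ℕ) (hi : i ≤ n) :
    expLaw n * (n.choose i : ℕ) = expLaw i * expLaw (n - i) := by
  have h1 := n.factorial_ne_zero
  have h2 := i.factorial_ne_zero
  have h3 := (n - i).factorial_ne_zero
  have hp : Real.log 2 ^ n = Real.log 2 ^ i * Real.log 2 ^ (n - i) := by
    rw [← pow_add, Nat.add_sub_cancel' hi]
  simp only [expLaw]
  rw [Nat.cast_choose ℝ hi, hp]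
  field_simp

lemma expLaw_zero : expLaw 0 = 1 := by simp [expLaw]

lemma summable_pow_mul_expLaw (k : ℕ) : Summable fun l : ℕ => (l : ℝ) ^ k * expLaw l := by
  refine Summable.of_nonneg_of_le (fun l => mul_nonneg (by positivity) (expLaw_pos l).le)
    (fun l => ?_) ((Real.summable_pow_div_factorial (Real.exp 1 * Real.log 2)).mul_left
      (k.factorial : ℝ))
  -- From the exponential series, `l ^ k ≤ k! * exp l`, so every moment is dominated by another
  -- exponential series.
  have h1 := Real.pow_div_factorial_le_exp (l : ℝ) l.cast_nonneg k
  rw [div_le_iff₀' (by positivity)] at h1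
  rw [mul_pow, ← Real.exp_nat_mul, mul_one, mul_div_assoc, ← mul_assoc]
  exact mul_le_mul_of_nonneg_right h1 (expLaw_pos l).le

/-- The renewal probabilities of the block law. -/
lemma prefArr_renewal (n : ℕ) :
    (prefArr (n + 1) : ℝ) * Real.log 2 ^ (n + 1) / (n + 1).factorial
      = ∑ i ∈ Finset.range (n + 1), expLaw (i + 1)
        * ((prefArr (n - i) : ℝ) * Real.log 2 ^ (n - i) / (n - i).factorial) := by
  -- Reflection indexes the weak-order recursion by the size `i + 1` of the class split off instead
  -- of by the remainder.
  rw [prefArr_succ, ← Finset.sum_range_reflect]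
  push_cast
  rw [Finset.sum_mul, Finset.sum_div]
  refine Finset.sum_congr rfl fun i hi => ?_
  rw [Finset.mem_range] at hi
  rw [Nat.cast_choose ℝ (show n - i ≤ n + 1 by omega),
    show n + 1 - (n - i) = i + 1 by omega, expLaw]
  have hp : Real.log 2 ^ (n + 1) = Real.log 2 ^ (i + 1) * Real.log 2 ^ (n - i) := by
    rw [← pow_add]
    congr 1
    omega
  rw [hp]
  have := (n + 1).factorial_ne_zero
  have := (i + 1).factorial_ne_zero
  have := (n - i).factorial_ne_zero
  field_simp

lemma tendstoWithMoments_labeled {e : ℕ → ℕ} (he : ∀ᶠ n in atTop, e n < n) (d : ℕ∞)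
    (hlim : ∀ l, 1 ≤ l → Tendsto
      (fun n => (Nat.card {G : Labeled n // countLabeled (e n) G = l} : ℝ) / Nat.card (Labeled n))
      atTop (𝓝 (expLaw l * (gam d / (2 * Real.log 2))))) :
    TendstoWithMoments uniformLabeled (fun n => countLabeled (e n)) (modPoisson d) := by
  obtain ⟨C, hC⟩ := peelableClass_labeled.exists_ratio_le blockLaw_expLaw
    expLaw_zero expLaw_pos fun n i _ hi => expLaw_mul_choose n i hi
  refine tendstoWithMoments_of_dominated _ _ _ (b := fun l => C * expLaw l) ?_ ?_ ?_
  · intro k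
    refine (((summable_nat_add_iff 1).2 (summable_pow_mul_expLaw k)).mul_left C).congr fun l => ?_
    ring
  · filter_upwards [hC, he] with n hn hn1 l hl
    rw [uniformLabeled_real]
    exact hn (e n) l hn1 hl
  · intro l hl
    rw [modPoisson_real, modPoissonProb_eq_mul d hl]
    simp only [uniformLabeled_real]
    exact hlim l hl

lemma tendstoWithMoments_labeled_fixed (d : ℕ) :
    TendstoWithMoments uniformLabeled (fun _ => countLabeled d) (modPoisson d) := by
  refine tendstoWithMoments_labeled (eventually_gt_atTop d) d fun l hl => ?_
  rw [gam_div]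
  exact peelableClass_labeled.tendsto_fixed blockLaw_expLaw expLaw_zero expLaw_pos
    (fun n i _ hi => expLaw_mul_choose n i hi) hl
    (u := fun n => (prefArr n : ℝ) * Real.log 2 ^ n / n.factorial)
    (by simp [prefArr]) prefArr_renewal d

lemma tendstoWithMoments_labeled_fixed_compl (d : ℕ) :
    TendstoWithMoments uniformLabeled (fun n => countLabeled (n - 1 - d)) (modPoisson d) := by
  refine tendstoWithMoments_labeled ?_ d fun l hl => ?_
  · filter_upwards [eventually_ge_atTop 1] with n hn
    omega
  rw [gam_div]
  exact peelableClass_labeled.tendsto_fixed_compl blockLaw_expLaw expLaw_zero expLaw_pos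
    (fun n i _ hi => expLaw_mul_choose n i hi) hl
    (u := fun n => (prefArr n : ℝ) * Real.log 2 ^ n / n.factorial)
    (by simp [prefArr]) prefArr_renewal d

lemma tendstoWithMoments_labeled_atTop {d : ℕ → ℕ} (hd : Tendsto d atTop atTop)
    (hd' : Tendsto (fun n => n - 1 - d n) atTop atTop) :
    TendstoWithMoments uniformLabeled (fun n => countLabeled (d n)) (modPoisson ⊤) := by
  refine tendstoWithMoments_labeled ?_ ⊤ fun l hl => ?_
  · filter_upwards [hd'.eventually_ge_atTop 1] with n hn
    omega
  rw [gam_top]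
  exact peelableClass_labeled.tendsto_of_atTop blockLaw_expLaw expLaw_zero expLaw_pos
    (fun n i _ hi => expLaw_mul_choose n i hi) hl le_rfl hd hd'

lemma TendstoWithMoments.tendsto_mean_modPoisson {X : (n : ℕ) → Labeled n → ℕ} {d : ℕ∞}
    (h : TendstoWithMoments uniformLabeled X (modPoisson d)) :
    Tendsto (fun n => ∫ G, (X n G : ℝ) ∂(uniformLabeled n)) atTop (𝓝 (gam d)) := by
  have := h.tendsto_moment 1
  simpa only [pow_one, integral_modPoisson] using this

/-- Complementation is a bijection of the uniform space exchanging degree and codegree. -/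
lemma identDistrib_labeled {n d : ℕ} (hd : d < n) :
    IdentDistrib (countLabeled (n := n) d) (countLabeled (n := n) (n - 1 - d))
      (uniformLabeled n) (uniformLabeled n) where
  aemeasurable_fst := Measurable.of_discrete.aemeasurable
  aemeasurable_snd := Measurable.of_discrete.aemeasurable
  map_eq := by
    refine Measure.ext_of_singleton fun l => ?_
    rw [Measure.map_apply Measurable.of_discrete (measurableSet_singleton l),
      Measure.map_apply Measurable.of_discrete (measurableSet_singleton l)]
    refine (measureReal_eq_measureReal_iff).1 ?_
    refine (uniformLabeled_real d l).trans (Eq.trans ?_ (uniformLabeled_real (n - 1 - d) l).symm)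
    rw [peelableClass_labeled.card_symm hd]

end ThresholdGraph

end

/-! ### The main theorem -/

theorem theorem7p4 :
    -- Unlabeled case: for any sequence `d = d(n)` with `0 ≤ d ≤ n - 1`.
    (∀ d : ℕ → ℕ, (∀ n, 1 ≤ n → d n ≤ n - 1) →
      ThresholdGraph.TendstoWithMoments ThresholdGraph.uniformUnlabeled
        (fun n => ThresholdGraph.countUnlabeled (d n))
        (geometricMeasure ThresholdGraph.half)) ∧
    -- The law of `X_d`, `0 ≤ d ≤ ∞`, is a modified Poisson law with mean `γ_d`.
    (∀ d : ℕ∞,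
      (∀ l : ℕ, 1 ≤ l → (ThresholdGraph.modPoisson d).real {l} =
        ThresholdGraph.gam d / Real.log 2 * (poissonMeasure ThresholdGraph.logTwo).real {l}) ∧
      (∀ l : ℕ, 1 ≤ l → (ThresholdGraph.modPoisson d).real {l} =
        ThresholdGraph.gam d * (Real.log 2 ^ (l - 1) / (2 * (l.factorial : ℝ)))) ∧
      (ThresholdGraph.modPoisson d).real {0} =
        1 - ThresholdGraph.gam d / (2 * Real.log 2) ∧
      Integrable (fun x : ℕ => (x : ℝ)) (ThresholdGraph.modPoisson d) ∧
      ∫ x : ℕ, (x : ℝ) ∂(ThresholdGraph.modPoisson d) = ThresholdGraph.gam d) ∧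
    -- Labeled case: symmetry in distribution.
    (∀ n d : ℕ, d < n →
      IdentDistrib (ThresholdGraph.countLabeled (n := n) d)
        (ThresholdGraph.countLabeled (n := n) (n - 1 - d))
        (ThresholdGraph.uniformLabeled n) (ThresholdGraph.uniformLabeled n)) ∧
    -- Labeled case: every fixed `d ≥ 0`.
    (∀ d : ℕ,
      ThresholdGraph.TendstoWithMoments ThresholdGraph.uniformLabeled
        (fun _ => ThresholdGraph.countLabeled d) (ThresholdGraph.modPoisson d) ∧
      ThresholdGraph.TendstoWithMoments ThresholdGraph.uniformLabeled
        (fun n => ThresholdGraph.countLabeled (n - 1 - d)) (ThresholdGraph.modPoisson d) ∧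
      Tendsto (fun n => ∫ G : ThresholdGraph.Labeled n, (ThresholdGraph.countLabeled d G : ℝ)
        ∂(ThresholdGraph.uniformLabeled n)) atTop (𝓝 (ThresholdGraph.gam d)) ∧
      Tendsto (fun n => ∫ G : ThresholdGraph.Labeled n,
        (ThresholdGraph.countLabeled (n - 1 - d) G : ℝ)
        ∂(ThresholdGraph.uniformLabeled n)) atTop (𝓝 (ThresholdGraph.gam d))) ∧
    -- Labeled case: every sequence `d = d(n) → ∞` with `n - d(n) → ∞`.
    (∀ d : ℕ → ℕ, Tendsto d atTop atTop → Tendsto (fun n : ℕ => (n : ℤ) - (d n : ℤ)) atTop atTop →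
      ThresholdGraph.TendstoWithMoments ThresholdGraph.uniformLabeled
        (fun n => ThresholdGraph.countLabeled (d n)) (ThresholdGraph.modPoisson ⊤) ∧
      ThresholdGraph.TendstoWithMoments ThresholdGraph.uniformLabeled
        (fun n => ThresholdGraph.countLabeled (n - 1 - d n)) (ThresholdGraph.modPoisson ⊤) ∧
      Tendsto (fun n => ∫ G : ThresholdGraph.Labeled n, (ThresholdGraph.countLabeled (d n) G : ℝ)
        ∂(ThresholdGraph.uniformLabeled n)) atTop (𝓝 1) ∧
      Tendsto (fun n => ∫ G : ThresholdGraph.Labeled n,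
        (ThresholdGraph.countLabeled (n - 1 - d n) G : ℝ)
        ∂(ThresholdGraph.uniformLabeled n)) atTop (𝓝 1)) := by
  refine ⟨fun d hd => ThresholdGraph.tendstoWithMoments_unlabeled hd, fun d => ⟨?_, ?_, ?_, ?_, ?_⟩,
    fun n d hd => ThresholdGraph.identDistrib_labeled hd, fun d => ?_, fun d hd hd' => ?_⟩
  · intro l hl
    rw [ThresholdGraph.modPoisson_real, ThresholdGraph.modPoissonProb_eq_poisson d hl]
  · intro l hl
    rw [ThresholdGraph.modPoisson_real, ThresholdGraph.modPoissonProb_of_pos d hl]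
  · rw [ThresholdGraph.modPoisson_real, ThresholdGraph.modPoissonProb, if_pos rfl]
  · exact ThresholdGraph.integrable_modPoisson d
  · exact ThresholdGraph.integral_modPoisson d
  · have h1 := ThresholdGraph.tendstoWithMoments_labeled_fixed d
    have h2 := ThresholdGraph.tendstoWithMoments_labeled_fixed_compl d
    exact ⟨h1, h2, h1.tendsto_mean_modPoisson, h2.tendsto_mean_modPoisson⟩
  · have hc : Tendsto (fun n => n - 1 - d n) atTop atTop := by
      refine tendsto_atTop.2 fun b => ?_
      filter_upwards [hd'.eventually_ge_atTop ((b : ℤ) + 1)] with n hn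
      omega
    -- Once `d n ≤ n - 1`, truncated subtraction is involutive, so the codegree statement is the
    -- degree statement for the sequence `n - 1 - d n`.
    have hcc : Tendsto (fun n => n - 1 - (n - 1 - d n)) atTop atTop := by
      refine hd.congr' ?_
      filter_upwards [hc.eventually_ge_atTop 1] with n hn
      omega
    have h1 := ThresholdGraph.tendstoWithMoments_labeled_atTop hd hc
    have h2 := ThresholdGraph.tendstoWithMoments_labeled_atTop hc hcc
    have h3 := h1.tendsto_mean_modPoisson
    have h4 := h2.tendsto_mean_modPoisson
    rw [ThresholdGraph.gam_top] at h3 h4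
    exact ⟨h1, h2, h3, h4⟩
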